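/- Let $n\ge 1$, $p\ge 0$, and let $\ell:\mathbb R\to[0,\infty)$ be twice differentiable, decreasing and $\beta$-smooth (i.e. $\ell'$ is $\beta$-Lipschitz), with $\ell'$ negative and bounded away from $0$ on every half-line $(-\infty,M]$. Assume that $-\ell'$ has a tight exponential tail: there are positive constants $a,c,\tau,\mu$ such that for all $u>\tau$ $$c\,(1-e^{-\mu u})\,e^{-au}\;\le\;-\ell'(u)\;\le\; c\,(1+e^{-\mu u})\,e^{-au}.$$ Fix labels $y_1,\dots,y_n\in\{\pm1\}$ and perturbation levels $\epsilon=(\epsilon_1,\dots,\epsilon_n)$ with all $\epsilon_i\ge 0$. For data $x_1,\dots,x_n\in\mathbb R^p$ let $X\in\mathbb R^{n\times p}$ be the matrix with rows $x_i^T$, let $\sigma_{\max}(X)$ be its largest singular value, let $\|\cdot\|$ be the Euclidean norm, and let $$\mathcal L_\epsilon(w)=\sum_{i=1}^n\max_{\|z_i\|\le\epsilon_i}\ell\big(y_i(x_i+z_i)^Tw\big)=\sum_{i=1}^n\ell\big(y_ix_i^Tw-\epsilon_i\|w\|\big).$$ The robust max-margin classifier $w_{RM}$ is the minimizer of $\|w\|$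 subject to $y_ix_i^Tw\ge 1+\epsilon_i\|w\|$ for $1\le i\le n$. Then for (Lebesgue) almost every dataset $(x_1,\dots,x_n)\in(\mathbb R^p)^n$ the following holds. Suppose that $w_{RM}$ exists, that $0<\eta<2\beta^{-1}(\sigma_{\max}(X)+\|\epsilon\|)^{-2}$, and that $(w_t)_{t\ge0}$ is a gradient descent sequence $w_{t+1}=w_t-\eta\nabla\mathcal L_\epsilon(w_t)$ from an arbitrary starting point $w_0$, such that $\mathcal L_\epsilon$ is differentiable at every iterate. Then $$\lim_{t\to\infty}\left\|\frac{w_t}{\|w_t\|}-\frac{w_{RM}}{\|w_{RM}\|}\right\|=0,$$ and the rate is logarithmic: there is a constant $C$ (which may depend on everything above) such that this distance is at most $C/\log t$ for all $t\ge2$. (For the finitely many $t$ at which $w_t$ may vanish, $w_t/\|w_t\|$ is read as $0$.) Moreover the resulting classifier converges to the robust max-margin classifier: for almost every $x\in\mathbb R^p$, $\operatorname{Sign}(w_t^Tx)\to\operatorname{Sign}(w_{RM}^Tx)$ as $t\to\infty$. -/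

import Mathlib

noncomputable section

/-- A function `f` has a tight exponential tail: for some positive constants `a, c, τ, μ`,
`c (1 - exp (-μ u)) exp (-a u) ≤ f u ≤ c (1 + exp (-μ u)) exp (-a u)` for all `u > τ`. -/
def TightExponentialTail (f : ℝ → ℝ) : Prop :=
  ∃ a c τ μ : ℝ, 0 < a ∧ 0 < c ∧ 0 < τ ∧ 0 < μ ∧ ∀ u : ℝ, τ < u →
    f u ≤ c * (1 + Real.exp (-μ * u)) * Real.exp (-a * u) ∧
    c * (1 - Real.exp (-μ * u)) * Real.exp (-a * u) ≤ f u

/-- The adversarial loss `∑ i, max_{‖z‖ ≤ ε i} ℓ (y i * (x i + z)ᵀ w)`. -/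
def robustLoss {n p : ℕ} (ℓ : ℝ → ℝ) (ε : EuclideanSpace ℝ (Fin n)) (y : Fin n → ℝ)
    (x : Fin n → EuclideanSpace ℝ (Fin p)) (w : EuclideanSpace ℝ (Fin p)) : ℝ :=
  ∑ i, sSup ((fun z : EuclideanSpace ℝ (Fin p) => ℓ (y i * inner ℝ (x i + z) w)) ''
    Metric.closedBall 0 (ε i))

/-- The constraints `y i * (x i)ᵀ w ≥ 1 + ε i * ‖w‖` of the robust max-margin problem. -/
def RobustFeasible {n p : ℕ} (ε : EuclideanSpace ℝ (Fin n)) (y : Fin n → ℝ)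
    (x : Fin n → EuclideanSpace ℝ (Fin p)) (w : EuclideanSpace ℝ (Fin p)) : Prop :=
  ∀ i, 1 + ε i * ‖w‖ ≤ y i * inner ℝ (x i) w

/-- `v` is the robust max-margin classifier: a feasible vector of minimal Euclidean norm. -/
def IsRobustMaxMargin {n p : ℕ} (ε : EuclideanSpace ℝ (Fin n)) (y : Fin n → ℝ)
    (x : Fin n → EuclideanSpace ℝ (Fin p)) (v : EuclideanSpace ℝ (Fin p)) : Prop :=
  RobustFeasible ε y x v ∧ ∀ w, RobustFeasible ε y x w → ‖v‖ ≤ ‖w‖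

/-- The data matrix, with rows `x i`. -/
def dataMatrix {n p : ℕ} (x : Fin n → EuclideanSpace ℝ (Fin p)) : Matrix (Fin n) (Fin p) ℝ :=
  Matrix.of fun i j => x i j

/-- The largest singular value of a real matrix (Mathlib lists singular values in decreasing
order, starting at index `0`). -/
def sigmaMax {n p : ℕ} (A : Matrix (Fin n) (Fin p) ℝ) : ℝ :=
  (Matrix.toEuclideanLin A).singularValues 0

/-- `w` is a well-defined gradient descent sequence for `F` with step size `η`: the objective is
differentiable at every iterate, so that the update rule makes sense. -/
def IsGradientDescent {p : ℕ} (F : EuclideanSpace ℝ (Fin p) → ℝ) (η : ℝ)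
    (w : ℕ → EuclideanSpace ℝ (Fin p)) : Prop :=
  ∀ t, DifferentiableAt ℝ F (w t) ∧ w (t + 1) = w t - η • gradient F (w t)

/-- The direction `w / ‖w‖` of a vector. -/
def direction {p : ℕ} (w : EuclideanSpace ℝ (Fin p)) : EuclideanSpace ℝ (Fin p) :=
  ‖w‖⁻¹ • w

/-- The binary classifier `x ↦ Sign (wᵀ x)`. -/
def classifier {p : ℕ} (w x : EuclideanSpace ℝ (Fin p)) : ℝ :=
  Real.sign (inner ℝ w x)

end

open Real Filter Topology

/-! ### Scalar estimates for the loss and its derivative -/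

/-! The robust loss is a sum of `ℓ` at the robust margins, which are concave and positively
homogeneous in `w`. Let `W` be the max-margin vector, `G i` the margin gradients at `W`, and `α` its
multipliers, so that `W = ∑ α i • G i` (`exists_isRobustKKT`).

For almost every dataset every active constraint has a positive multiplier
(`ae_strict_complementarity`). Then the active gradients are linearly independent, and there is `v ⟂
W` with `exp (-a ⟪G i, v⟫)` proportional to `α i` on the active set (`exists_offset`). Near `s • W +
v`, for large `s`, the exponential tail weights the active gradients like `α`, so the descent force
points along `W` to leading order. The ray translated by `v` is therefore almost invariant.

Descent reaches the region where all margins are large. Otherwise `⟪w t, W⟫` would grow linearly in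
`t`, while the step-size bound lets `‖w t‖ ^ 2` grow at most linearly. In that region the loss
decreases at each step by a multiple of the squared step length, so the region is never left
(`exists_eventually_margin_ge`).

From then on, write `w t = s • W + v + ρ` with `ρ ⟂ W`. The coordinate `s` increases by at least a
multiple of `exp (-a s)` per step, hence grows at least like `log t`. One step increases `‖ρ‖ ^ 2`
by at most `O(exp (-a s) / s ^ 2) * (1 + ‖ρ‖ ^ 2)` plus the squared step length
(`inner_marginForce_rayDeviation_le`). Both errors are summable, the first by telescoping `1 / s`
and the second by telescoping the loss (`bounded_of_exp_driven`). So `ρ` stays bounded, and the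
direction of `w t` differs from that of `W` by `O(1 / s) = O(1 / log t)`. -/

theorem le_quadratic_of_lipschitzWith_deriv {f : ℝ → ℝ} {β : NNReal} (hf : Differentiable ℝ f)
    (hβ : LipschitzWith β (deriv f)) (u v : ℝ) :
    f v ≤ f u + deriv f u * (v - u) + β / 2 * (v - u) ^ 2 := by
  set φ : ℝ → ℝ := fun s => f s - deriv f u * (s - u) - β / 2 * (s - u) ^ 2 with hφ
  have hd : ∀ s, HasDerivAt φ (deriv f s - deriv f u - β * (s - u)) s := by
    intro s
    have h1 : HasDerivAt (fun s => s - u) 1 s := (hasDerivAt_id s).sub_const u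
    have := ((hf s).hasDerivAt.sub (h1.const_mul (deriv f u))).sub
      ((h1.pow 2).const_mul ((β : ℝ) / 2))
    refine this.congr_deriv ?_
    norm_num
    ring
  have hlip : ∀ s, |deriv f s - deriv f u| ≤ β * |s - u| := by
    intro s
    have := hβ.dist_le_mul s u
    rwa [Real.dist_eq, Real.dist_eq] at this
  have hdiff : Differentiable ℝ φ := fun s => (hd s).differentiableAt
  have key : φ v ≤ φ u := by
    rcases le_total u v with h | h
    · refine antitoneOn_of_deriv_nonpos (convex_Ici u) hdiff.continuous.continuousOn
        hdiff.differentiableOn (fun s hs => ?_) Set.self_mem_Ici h h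
      rw [interior_Ici] at hs
      rw [(hd s).deriv]
      have := hlip s
      rw [abs_of_pos (show 0 < s - u from sub_pos.2 hs)] at this
      linarith [le_abs_self (deriv f s - deriv f u)]
    · refine monotoneOn_of_deriv_nonneg (convex_Iic u) hdiff.continuous.continuousOn
        hdiff.differentiableOn (fun s hs => ?_) h Set.self_mem_Iic h
      rw [interior_Iic] at hs
      rw [(hd s).deriv]
      have := hlip s
      rw [abs_of_neg (show s - u < 0 from sub_neg.2 hs)] at this
      linarith [neg_abs_le (deriv f s - deriv f u)]
  simp only [hφ, sub_self] at key
  linarith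

theorem mul_exp_neg_mul_le {b : ℝ} (hb : 0 < b) (x : ℝ) : x * exp (-(b * x)) ≤ 1 / b := by
  have h1 : b * x ≤ exp (b * x) := by linarith [add_one_le_exp (b * x)]
  rw [le_div_iff₀ hb]
  calc x * exp (-(b * x)) * b = b * x * exp (-(b * x)) := by ring
    _ ≤ exp (b * x) * exp (-(b * x)) := by gcongr
    _ = 1 := by rw [← exp_add]; simp

/-! ### Consequences of the exponential tail. -/

section Tail

variable {r : ℝ → ℝ} {a c τ μ : ℝ}

theorem tail_le_two_mul (hc : 0 < c) (hτ : 0 < τ) (hμ : 0 < μ)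
    (hub : ∀ u, τ < u → r u ≤ c * (1 + exp (-μ * u)) * exp (-a * u)) {u : ℝ} (hu : τ < u) :
    r u ≤ 2 * c * exp (-a * u) := by
  refine (hub u hu).trans ?_
  have : exp (-μ * u) ≤ 1 := exp_le_one_iff.2 (by nlinarith [hτ.trans hu])
  have : c * (1 + exp (-μ * u)) ≤ 2 * c := by nlinarith
  gcongr

theorem tail_bounded (hr : Continuous r) (ha : 0 < a) (hc : 0 < c) (hτ : 0 < τ) (hμ : 0 < μ)
    (hub : ∀ u, τ < u → r u ≤ c * (1 + exp (-μ * u)) * exp (-a * u)) :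
    ∃ K, ∀ u, 0 ≤ u → r u ≤ K ∧ r u * u ≤ K := by
  obtain ⟨K₁, hK₁⟩ := (isCompact_Icc (a := (0 : ℝ)) (b := τ)).exists_bound_of_continuousOn
    hr.continuousOn
  obtain ⟨K₂, hK₂⟩ := (isCompact_Icc (a := (0 : ℝ)) (b := τ)).exists_bound_of_continuousOn
    (hr.mul continuous_id).continuousOn
  refine ⟨max (max K₁ K₂) (max (2 * c) (2 * c / a)), fun u hu => ?_⟩
  rcases le_or_gt u τ with h | h
  · have h1 := (le_abs_self _).trans (hK₁ u ⟨hu, h⟩)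
    have h2 := (le_abs_self _).trans (hK₂ u ⟨hu, h⟩)
    exact ⟨h1.trans (by simp), h2.trans (by simp)⟩
  · have h1 := tail_le_two_mul hc hτ hμ hub h
    constructor
    · have : exp (-a * u) ≤ 1 := exp_le_one_iff.2 (by nlinarith)
      have : r u ≤ 2 * c := by nlinarith
      exact this.trans (by simp)
    · have h2 : r u * u ≤ 2 * c * exp (-a * u) * u := by gcongr
      have h3 := mul_exp_neg_mul_le ha u
      have : r u * u ≤ 2 * c / a := by
        calc r u * u ≤ 2 * c * (u * exp (-(a * u))) := by
              rw [← neg_mul]; linarith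
          _ ≤ 2 * c * (1 / a) := by gcongr
          _ = 2 * c / a := by ring
      exact this.trans (by simp)

/-- With `q = η * S ^ 2` this bounds what one data point adds to `‖w‖ ^ 2 / η` in a step. On the
negative side smoothness forces `u ≤ (r 0 - r u) / β`, so `2 * r u * u` contains `-(2 / β) * r u ^
2`, which beats the quadratic term. The constant is the maximum of the remaining concave parabola in
`r u`. -/
theorem two_mul_add_sq_bounded {β q K₀ : ℝ} (hβ : 0 < β) (hq : 0 ≤ q) (hqβ : q < 2 / β)
    (hr0 : ∀ u, 0 ≤ r u) (hgrow : ∀ u, r u ≤ r 0 + β * |u|)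
    (hK : ∀ u, 0 ≤ u → r u ≤ K₀ ∧ r u * u ≤ K₀) :
    ∃ K, ∀ u, 2 * (r u * u) + q * r u ^ 2 ≤ K := by
  set ν := 2 / β - q with hν
  have hνpos : 0 < ν := sub_pos.2 hqβ
  refine ⟨max (2 * K₀ + q * K₀ ^ 2) ((r 0 / β) ^ 2 / ν), fun u => ?_⟩
  rcases le_total 0 u with hu | hu
  · refine le_trans ?_ (le_max_left _ _)
    obtain ⟨h1, h2⟩ := hK u hu
    have := pow_le_pow_left₀ (hr0 u) h1 2
    nlinarith
  · refine le_trans ?_ (le_max_right _ _)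
    have h1 := hgrow u
    rw [abs_of_nonpos hu] at h1
    have h2 : u ≤ (r 0 - r u) / β := by
      rw [le_div_iff₀ hβ]; linarith
    have h3 : r u * u ≤ r u * ((r 0 - r u) / β) := mul_le_mul_of_nonneg_left h2 (hr0 u)
    rw [le_div_iff₀ hνpos]
    have h4 : 2 * (r u * u) + q * r u ^ 2 ≤ 2 * (r 0 / β) * r u - ν * r u ^ 2 := by
      calc _ ≤ 2 * (r u * ((r 0 - r u) / β)) + q * r u ^ 2 := by linarith
        _ = _ := by rw [hν]; field_simp; ring
    nlinarith [sq_nonneg (r 0 / β - ν * r u), mul_le_mul_of_nonneg_right h4 hνpos.le]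

/-- In the tail, `r` behaves like `c * exp (-a * ·)`: it is strongly decreasing up to an error of
smaller exponential order. -/
theorem tail_contraction (ha : 0 < a) (hc : 0 < c) (hμ : 0 < μ)
    (htail : ∀ u, τ < u → r u ≤ c * (1 + exp (-μ * u)) * exp (-a * u) ∧
      c * (1 - exp (-μ * u)) * exp (-a * u) ≤ r u)
    {U : ℝ} (hU : τ < U) (hU4 : exp (-μ * U) ≤ 1 / 4) :
    ∃ κ C : ℝ, 0 < κ ∧ 0 < C ∧ ∀ u v, U ≤ u →
      (r u - c * exp (-a * v)) * (u - v) ≤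
        -κ * exp (-a * v) * min |u - v| ((u - v) ^ 2) + C * exp (-(a + μ) * v) := by
  refine ⟨c * a / (2 * (1 + a)), c / a * exp ((a + μ) / a), by positivity, by positivity,
    fun u v hu => ?_⟩
  obtain ⟨h1, h2⟩ := htail u (hU.trans_le hu)
  have hE : ∀ b x : ℝ, exp (-b * (v + x)) = exp (-b * v) * exp (-(b * x)) := fun b x => by
    rw [← exp_add]; ring_nf
  have hsplit : exp (-μ * u) * exp (-a * u) = exp (-(a + μ) * u) := by
    rw [← exp_add]; ring_nf
  have hone : 1 ≤ exp ((a + μ) / a) := one_le_exp (by positivity)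
  set x := u - v with hx
  have hux : u = v + x := by rw [hx]; ring
  rcases le_total 0 x with hx0 | hx0
  -- Right of `v`, `1 - exp (-a x)` saturates, so the gain is only linear for large `x`; hence the
  -- minimum of `|x|` and `x ^ 2`.
  · have hb : r u ≤ c * exp (-a * v) * exp (-(a * x)) +
        c * (exp (-(a + μ) * v) * exp (-((a + μ) * x))) := by
      rw [← hE, mul_assoc, ← hE, ← hux, ← hsplit]; linarith
    have h3 : x * exp (-((a + μ) * x)) ≤ 1 / a :=
      (mul_exp_neg_mul_le (by positivity) x).trans
        (one_div_le_one_div_of_le ha (by linarith))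
    have h4 : exp (-(a * x)) * (1 + a * x) ≤ 1 := by
      rw [exp_neg, inv_mul_le_iff₀ (exp_pos _)]; linarith [add_one_le_exp (a * x)]
    have h5 : a / (1 + a) * min |x| (x ^ 2) ≤ (1 - exp (-(a * x))) * x := by
      have hmin : min |x| (x ^ 2) * (1 + a * x) ≤ (1 + a) * x ^ 2 := by
        rcases le_total x 1 with h | h
        · have : min |x| (x ^ 2) ≤ x ^ 2 := min_le_right _ _
          have h' : 1 + a * x ≤ 1 + a := by nlinarith
          calc _ ≤ x ^ 2 * (1 + a) := by gcongr
            _ = _ := by ring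
        · have : min |x| (x ^ 2) ≤ x := (min_le_left _ _).trans_eq (abs_of_nonneg hx0)
          have h' : 1 + a * x ≤ x * (1 + a) := by nlinarith
          calc _ ≤ x * (x * (1 + a)) := by gcongr
            _ = _ := by ring
      have h6 : a * x ≤ (1 - exp (-(a * x))) * (1 + a * x) := by linarith
      have hpos : 0 < 1 + a * x := by positivity
      rw [div_mul_eq_mul_div, div_le_iff₀ (by positivity)]
      have h7 : a * x * x * (1 + a) ≤ (1 - exp (-(a * x))) * (1 + a * x) * x * (1 + a) := by
        gcongr
      refine le_of_mul_le_mul_right ?_ hpos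
      nlinarith [mul_le_mul_of_nonneg_left hmin ha.le]
    have hv := exp_pos (-a * v)
    have hv' := exp_pos (-(a + μ) * v)
    have hmin0 : 0 ≤ min |x| (x ^ 2) := le_min (abs_nonneg _) (sq_nonneg _)
    calc (r u - c * exp (-a * v)) * x
        ≤ (c * exp (-a * v) * exp (-(a * x)) +
          c * (exp (-(a + μ) * v) * exp (-((a + μ) * x))) - c * exp (-a * v)) * x := by gcongr
      _ = -(c * exp (-a * v) * ((1 - exp (-(a * x))) * x)) +
          c * exp (-(a + μ) * v) * (x * exp (-((a + μ) * x))) := by ring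
      _ ≤ -(c * exp (-a * v) * (a / (1 + a) * min |x| (x ^ 2))) +
          c * exp (-(a + μ) * v) * (1 / a) := by gcongr
      _ = -(c * a / (1 + a)) * exp (-a * v) * min |x| (x ^ 2) +
          c / a * 1 * exp (-(a + μ) * v) := by ring
      _ ≤ _ := by
          gcongr
          linarith
  · have hy0 : 0 ≤ -x := by linarith
    set y := -x with hy
    have hxy : x = -y := by rw [hy]; ring
    have hb : c * exp (-a * u) - c * exp (-(a + μ) * u) ≤ r u := by
      rw [← hsplit]; linarith
    have hEu : exp (-a * u) = exp (-a * v) * exp (a * y) := by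
      rw [hux, hE, hxy]; ring_nf
    have hv := exp_pos (-a * v)
    have hv' := exp_pos (-(a + μ) * v)
    have hμu : exp (-μ * u) ≤ 1 / 4 := (exp_le_exp.2 (by nlinarith)).trans hU4
    -- Left of `v` the error can be large. Beyond distance `1 / a`, the bound `exp (-μ u) ≤ 1 / 4`
    -- keeps it below half of the gain; within that distance it is comparable to `exp (-(a + μ) v)`.
    have herr : y * exp (-(a + μ) * u) ≤ 1 / 2 * y * (exp (-a * u) - exp (-a * v)) +
        1 / a * exp ((a + μ) / a) * exp (-(a + μ) * v) := by
      have hmono : exp (-a * v) ≤ exp (-a * u) := exp_le_exp.2 (by nlinarith)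
      rcases le_total (1 / a) y with h | h
      · have hay : 1 ≤ a * y := by rwa [div_le_iff₀' ha] at h
        have h6 : 2 * exp (-a * v) ≤ exp (-a * u) := by
          rw [hEu]
          nlinarith [add_one_le_exp (a * y)]
        have h7 : exp (-(a + μ) * u) ≤ 1 / 2 * (exp (-a * u) - exp (-a * v)) := by
          rw [← hsplit]
          nlinarith [exp_pos (-a * u)]
        have h8 : 0 ≤ 1 / a * exp ((a + μ) / a) * exp (-(a + μ) * v) := by positivity
        nlinarith
      · have h6 : exp (-(a + μ) * u) ≤ exp ((a + μ) / a) * exp (-(a + μ) * v) := by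
          rw [hux, hE, mul_comm]
          gcongr
          rw [hxy, div_eq_mul_one_div]
          nlinarith
        have h7 : y * exp (-(a + μ) * u) ≤ 1 / a * (exp ((a + μ) / a) * exp (-(a + μ) * v)) := by
          gcongr
        have h8 : 0 ≤ 1 / 2 * y * (exp (-a * u) - exp (-a * v)) :=
          mul_nonneg (by positivity) (by linarith)
        linarith
    have hgrow : a * y * exp (-a * v) ≤ exp (-a * u) - exp (-a * v) := by
      rw [hEu]; nlinarith [add_one_le_exp (a * y)]
    have hmin : min |x| (x ^ 2) ≤ y ^ 2 := (min_le_right _ _).trans_eq (by rw [hy]; ring)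
    have hmin0 : 0 ≤ min |x| (x ^ 2) := le_min (abs_nonneg _) (sq_nonneg _)
    have hκ : c * a / (2 * (1 + a)) ≤ c * a / 2 := by
      gcongr; linarith
    have h9 : c * a / (2 * (1 + a)) * exp (-a * v) * min |x| (x ^ 2) ≤
        c * a / 2 * exp (-a * v) * y ^ 2 := by gcongr
    calc (r u - c * exp (-a * v)) * x = -(y * (r u - c * exp (-a * v))) := by rw [hxy]; ring
      _ ≤ -(y * (c * exp (-a * u) - c * exp (-(a + μ) * u) - c * exp (-a * v))) := by gcongr
      _ = -(c * y * (exp (-a * u) - exp (-a * v))) + c * (y * exp (-(a + μ) * u)) := by ring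
      _ ≤ -(c * y * (exp (-a * u) - exp (-a * v))) +
          c * (1 / 2 * y * (exp (-a * u) - exp (-a * v)) +
            1 / a * exp ((a + μ) / a) * exp (-(a + μ) * v)) := by gcongr
      _ = -(c * y / 2 * (exp (-a * u) - exp (-a * v))) +
          c / a * exp ((a + μ) / a) * exp (-(a + μ) * v) := by ring
      _ ≤ -(c * y / 2 * (a * y * exp (-a * v))) +
          c / a * exp ((a + μ) / a) * exp (-(a + μ) * v) := by gcongr
      _ ≤ _ := by linarith

theorem tail_mul_sub_le (ha : 0 < a) (hc : 0 < c) (hτ : 0 < τ) (hμ : 0 < μ) (hr0 : ∀ u, 0 ≤ r u)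
    (hub : ∀ u, τ < u → r u ≤ c * (1 + exp (-μ * u)) * exp (-a * u)) {u : ℝ} (hu : τ < u)
    (v : ℝ) : r u * (u - v) ≤ 2 * c / a * exp (-a * v) := by
  rcases le_total u v with h | h
  · exact (mul_nonpos_of_nonneg_of_nonpos (hr0 u) (by linarith)).trans (by positivity)
  · have h1 := tail_le_two_mul hc hτ hμ hub hu
    have h2 : exp (-a * u) = exp (-a * v) * exp (-(a * (u - v))) := by
      rw [← exp_add]; ring_nf
    have h3 := mul_exp_neg_mul_le ha (u - v)
    have h0 : 0 ≤ u - v := by linarith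
    calc r u * (u - v) ≤ 2 * c * exp (-a * u) * (u - v) := by gcongr
      _ = 2 * c * exp (-a * v) * ((u - v) * exp (-(a * (u - v)))) := by rw [h2]; ring
      _ ≤ 2 * c * exp (-a * v) * (1 / a) := by gcongr
      _ = _ := by ring

end Tail

/-- Young's inequality when `|x| ≤ 1`; when `|x| ≥ 1` the linear branch absorbs the perturbation
because `K / s ≤ κ`. This turns first-order errors `1 / s` into summable ones `1 / s ^ 2`. -/
theorem neg_mul_min_add_le {κ K s : ℝ} (hκ : 0 < κ) (hK : 0 ≤ K) (hs : 0 < s) (hKs : K ≤ κ * s)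
    (x : ℝ) : -κ * min |x| (x ^ 2) + K / s * |x| ≤ K ^ 2 / κ * (1 / s ^ 2) := by
  have hR : K ^ 2 / κ * (1 / s ^ 2) = (K / s) ^ 2 / κ := by field_simp
  rw [hR]
  have hk : K / s ≤ κ := by rwa [div_le_iff₀ hs]
  have hk0 : 0 ≤ K / s := by positivity
  set k := K / s
  have h0 := abs_nonneg x
  rw [← sq_abs x]
  set y := |x|
  rcases le_total y 1 with h | h
  · rw [min_eq_right (by nlinarith)]
    rw [le_div_iff₀ hκ]
    nlinarith [sq_nonneg (k - 2 * κ * y), sq_nonneg k]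
  · rw [min_eq_left (by nlinarith)]
    have : 0 ≤ k ^ 2 / κ := by positivity
    nlinarith

/-! ### Robust margins -/

section Margin

variable {E : Type*} [NormedAddCommGroup E] [InnerProductSpace ℝ E]

/-- The worst-case margin `⟪z, w⟫ - e ‖w‖` of `w` under perturbations of `z` of norm at most `e`. -/
noncomputable def robustMargin (z : E) (e : ℝ) (w : E) : ℝ := inner ℝ z w - e * ‖w‖

/-- The gradient of `robustMargin z e` at `w ≠ 0`. -/
noncomputable def marginGrad (z : E) (e : ℝ) (w : E) : E := z - e • (‖w‖⁻¹ • w)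

theorem norm_inv_norm_smul_le (w : E) : ‖‖w‖⁻¹ • w‖ ≤ 1 := by
  rw [norm_smul, norm_inv, norm_norm]
  exact inv_mul_le_one

theorem inner_inv_norm_smul_le (w v : E) : inner ℝ (‖w‖⁻¹ • w) v ≤ ‖v‖ :=
  (real_inner_le_norm _ _).trans
    ((mul_le_mul_of_nonneg_right (norm_inv_norm_smul_le w) (norm_nonneg v)).trans_eq (one_mul _))

theorem inner_inv_norm_smul_self (w : E) : inner ℝ (‖w‖⁻¹ • w) w = ‖w‖ := by
  rcases eq_or_ne w 0 with rfl | hw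
  · simp
  · have := norm_ne_zero_iff.2 hw
    rw [real_inner_smul_left, real_inner_self_eq_norm_sq]
    field_simp

theorem inner_marginGrad (z : E) (e : ℝ) (w v : E) :
    inner ℝ (marginGrad z e w) v = inner ℝ z v - e * inner ℝ (‖w‖⁻¹ • w) v := by
  rw [marginGrad, inner_sub_left, real_inner_smul_left]

theorem inner_marginGrad_self (z : E) (e : ℝ) (w : E) :
    inner ℝ (marginGrad z e w) w = robustMargin z e w := by
  rw [inner_marginGrad, inner_inv_norm_smul_self, robustMargin]

/-- The supergradient inequality of a concave function; homogeneity removes the constant term. It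
also holds at `w = 0`, where `‖w‖⁻¹ • w` is `0`. -/
theorem robustMargin_le_inner_marginGrad (z : E) {e : ℝ} (he : 0 ≤ e) (w v : E) :
    robustMargin z e v ≤ inner ℝ (marginGrad z e w) v := by
  rw [inner_marginGrad, robustMargin]
  have := mul_le_mul_of_nonneg_left (inner_inv_norm_smul_le w v) he
  linarith

theorem inner_marginGrad_sub_le (z : E) {e : ℝ} (he : 0 ≤ e) (w q : E) :
    inner ℝ (marginGrad z e w) (w - q) ≤ robustMargin z e w - robustMargin z e q := by
  rw [inner_sub_right, inner_marginGrad_self]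
  have := robustMargin_le_inner_marginGrad z he w q
  linarith

/-- AM–GM applied to `‖w + d‖ * ‖w‖`. The curvature of the norm is of order `1 / ‖w‖`, so the
margins are nearly linear far from the origin. -/
theorem norm_add_le_quadratic {w : E} (hw : w ≠ 0) (d : E) :
    ‖w + d‖ ≤ ‖w‖ + inner ℝ (‖w‖⁻¹ • w) d + ‖d‖ ^ 2 / (2 * ‖w‖) := by
  have hpos : 0 < ‖w‖ := norm_pos_iff.2 hw
  have h1 := norm_add_sq_real w d
  have h2 : ‖w‖ + inner ℝ (‖w‖⁻¹ • w) d + ‖d‖ ^ 2 / (2 * ‖w‖) =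
      (‖w + d‖ ^ 2 + ‖w‖ ^ 2) / (2 * ‖w‖) := by
    rw [h1, real_inner_smul_left]
    field_simp
    ring
  rw [h2, le_div_iff₀ (by positivity)]
  nlinarith [sq_nonneg (‖w + d‖ - ‖w‖)]

theorem norm_add_ge_linear {w : E} (d : E) :
    ‖w‖ + inner ℝ (‖w‖⁻¹ • w) d ≤ ‖w + d‖ := by
  have := inner_inv_norm_smul_le w (w + d)
  rwa [inner_add_right, inner_inv_norm_smul_self] at this

theorem robustMargin_add_ge (z : E) {e : ℝ} (he : 0 ≤ e) {w : E} (hw : w ≠ 0) (d : E) :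
    robustMargin z e w + inner ℝ (marginGrad z e w) d - e * (‖d‖ ^ 2 / (2 * ‖w‖)) ≤
      robustMargin z e (w + d) := by
  rw [inner_marginGrad, robustMargin, robustMargin, inner_add_right]
  have := mul_le_mul_of_nonneg_left (norm_add_le_quadratic hw d) he
  linarith

theorem robustMargin_smul (z : E) (e : ℝ) (w : E) {k : ℝ} (hk : 0 ≤ k) :
    robustMargin z e (k • w) = k * robustMargin z e w := by
  rw [robustMargin, robustMargin, real_inner_smul_right, norm_smul, Real.norm_of_nonneg hk]
  ring

theorem norm_inv_norm_smul_sub_le (x : E) {y : E} (hy : y ≠ 0) :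
    ‖‖x‖⁻¹ • x - ‖y‖⁻¹ • y‖ ≤ 2 * ‖x - y‖ / ‖y‖ := by
  have hpos : 0 < ‖y‖ := norm_pos_iff.2 hy
  have h1 : ‖y‖ • (‖x‖⁻¹ • x - ‖y‖⁻¹ • y) = (‖y‖ - ‖x‖) • (‖x‖⁻¹ • x) + (x - y) := by
    have hx : ‖x‖ • ‖x‖⁻¹ • x = x := by
      rcases eq_or_ne x 0 with rfl | hx
      · simp
      · rw [smul_smul, mul_inv_cancel₀ (norm_ne_zero_iff.2 hx), one_smul]
    have hy' : ‖y‖ • ‖y‖⁻¹ • y = y := by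
      rw [smul_smul, mul_inv_cancel₀ hpos.ne', one_smul]
    rw [smul_sub, sub_smul, hx, hy']
    abel
  rw [le_div_iff₀ hpos, mul_comm]
  calc ‖y‖ * ‖‖x‖⁻¹ • x - ‖y‖⁻¹ • y‖ = ‖(‖y‖ - ‖x‖) • (‖x‖⁻¹ • x) + (x - y)‖ := by
        rw [← h1, norm_smul, norm_norm]
    _ ≤ |‖y‖ - ‖x‖| * ‖‖x‖⁻¹ • x‖ + ‖x - y‖ := by
        refine (norm_add_le _ _).trans ?_
        rw [norm_smul, Real.norm_eq_abs]
    _ ≤ ‖x - y‖ * 1 + ‖x - y‖ := by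
        gcongr
        · rw [abs_sub_comm]; exact abs_norm_sub_norm_le x y
        · exact norm_inv_norm_smul_le x
    _ = 2 * ‖x - y‖ := by ring

/-! ### Optimality conditions of the robust max-margin problem -/

variable {ι : Type*} [Fintype ι]

/-- `W` satisfies the robust margin constraints and the Karush–Kuhn–Tucker conditions of the robust
max-margin problem with multipliers `α`. -/
structure IsRobustKKT (z : ι → E) (e : ι → ℝ) (W : E) (α : ι → ℝ) : Prop where
  nonneg : ∀ i, 0 ≤ α i
  feasible : ∀ i, 1 ≤ robustMargin (z i) (e i) W
  slack : ∀ i, α i * (robustMargin (z i) (e i) W - 1) = 0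
  stationary : W = ∑ i, α i • marginGrad (z i) (e i) W

namespace IsRobustKKT

variable {z : ι → E} {e : ι → ℝ} {W : E} {α : ι → ℝ}

theorem mul_margin (h : IsRobustKKT z e W α) (i : ι) :
    α i * robustMargin (z i) (e i) W = α i := by
  linarith [h.slack i]

theorem sum_eq (h : IsRobustKKT z e W α) : ∑ i, α i = ‖W‖ ^ 2 := by
  have h1 : inner ℝ (∑ i, α i • marginGrad (z i) (e i) W) W = ‖W‖ ^ 2 := by
    rw [← h.stationary, real_inner_self_eq_norm_sq]
  rw [← h1, sum_inner]
  refine Finset.sum_congr rfl fun i _ => ?_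
  rw [real_inner_smul_left, inner_marginGrad_self, h.mul_margin]

/-- As the multipliers sum to `‖W‖ ^ 2`, this says that the `α`-mean of the margins of `v` is at
most its coordinate along `W`. -/
theorem sum_mul_margin_le (he : ∀ i, 0 ≤ e i) (h : IsRobustKKT z e W α) (v : E) :
    ∑ i, α i * robustMargin (z i) (e i) v ≤ inner ℝ W v := by
  conv_rhs => rw [h.stationary]
  rw [sum_inner]
  refine Finset.sum_le_sum fun i _ => ?_
  rw [real_inner_smul_left]
  exact mul_le_mul_of_nonneg_left (robustMargin_le_inner_marginGrad _ (he i) _ _) (h.nonneg i)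

end IsRobustKKT

/-- The multipliers of a minimal-norm feasible point exist: otherwise `W` could be moved in a
direction improving all active constraints. -/
theorem exists_isRobustKKT [CompleteSpace E] {z : ι → E} {e : ι → ℝ} {W : E}
    (he : ∀ i, 0 ≤ e i) (hW : W ≠ 0) (hfeas : ∀ i, 1 ≤ robustMargin (z i) (e i) W)
    (hmin : ∀ v, (∀ i, 1 ≤ robustMargin (z i) (e i) v) → ‖W‖ ≤ ‖v‖) :
    ∃ α, IsRobustKKT z e W α := by
  classical
  have hN : 0 < ‖W‖ := norm_pos_iff.2 hW
  set S : Finset ι := Finset.univ.filter fun i => robustMargin (z i) (e i) W = 1 with hS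
  set G : ι → E := fun i => marginGrad (z i) (e i) W with hG
  have hGW : ∀ i ∈ S, inner ℝ (G i) W = 1 := fun i hi => by
    rw [hG, inner_marginGrad_self]; exact (Finset.mem_filter.1 hi).2
  have noDescent : ∀ d : E, inner ℝ W d = 0 → ∃ i ∈ S, inner ℝ (G i) d ≤ 0 := by
    intro d hd0
    by_contra! hd
    -- A move `t • d` orthogonal to `W` changes the norm only to order `t ^ 2` but the active
    -- margins to order `t`. This `M` lets division by `1 + t ^ 2 * M` keep feasibility while making
    -- the norm smaller than `‖W‖`.
    set M : ℝ := ‖d‖ ^ 2 / ‖W‖ ^ 2 + 1 with hM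
    have hMpos : 0 < M := by positivity
    have hev : ∀ i, ∀ᶠ t : ℝ in nhdsWithin 0 (Set.Ioi 0),
        1 + t ^ 2 * M ≤ robustMargin (z i) (e i) (W + t • d) := by
      intro i
      by_cases hi : i ∈ S
      · have hpos := hd i hi
        have hmi : robustMargin (z i) (e i) W = 1 := (Finset.mem_filter.1 hi).2
        set B : ℝ := M + e i * (‖d‖ ^ 2 / (2 * ‖W‖)) with hB
        have hBpos : 0 < B := by have := he i; positivity
        have hlt : ∀ᶠ t : ℝ in nhdsWithin 0 (Set.Ioi 0), t < inner ℝ (G i) d / B :=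
          nhdsWithin_le_nhds (gt_mem_nhds (by positivity))
        filter_upwards [hlt, self_mem_nhdsWithin] with t ht ht0
        have ht0' : 0 < t := ht0
        refine le_trans ?_ (robustMargin_add_ge (z i) (he i) hW (t • d))
        rw [hmi, real_inner_smul_right, norm_smul, Real.norm_of_nonneg ht0'.le]
        rw [lt_div_iff₀ hBpos] at ht
        have : t * (t * B) ≤ t * inner ℝ (G i) d := by gcongr
        have hexp : t ^ 2 * M + e i * ((t * ‖d‖) ^ 2 / (2 * ‖W‖)) = t * (t * B) := by
          rw [hB]; ring
        linarith
      · have hgt : 1 < robustMargin (z i) (e i) W :=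
          lt_of_le_of_ne (hfeas i) fun h => hi (Finset.mem_filter.2 ⟨Finset.mem_univ _, h.symm⟩)
        have hc1 : Continuous fun t : ℝ => 1 + t ^ 2 * M := by fun_prop
        have hc2 : Continuous fun t : ℝ => robustMargin (z i) (e i) (W + t • d) := by
          unfold robustMargin; fun_prop
        have := (hc1.tendsto 0).eventually_lt (hc2.tendsto 0) (by simpa using hgt)
        filter_upwards [nhdsWithin_le_nhds this] with t ht
        exact ht.le
    obtain ⟨t, ht, ht0⟩ := ((Filter.eventually_all.2 hev).and
      (self_mem_nhdsWithin (a := (0 : ℝ)) (s := Set.Ioi 0))).exists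
    have ht0' : 0 < t := ht0
    have hk : 0 < 1 + t ^ 2 * M := by positivity
    have hle := hmin ((1 + t ^ 2 * M)⁻¹ • (W + t • d)) fun i => by
      rw [robustMargin_smul _ _ _ (by positivity), inv_mul_eq_div, le_div_iff₀ hk, one_mul]
      exact ht i
    rw [norm_smul, Real.norm_of_nonneg (by positivity), inv_mul_eq_div, le_div_iff₀ hk] at hle
    have hsq := pow_le_pow_left₀ (by positivity) hle 2
    rw [norm_add_sq_real, real_inner_smul_right, hd0, norm_smul, Real.norm_of_nonneg ht0'.le] at hsq
    have hMN : M * ‖W‖ ^ 2 = ‖d‖ ^ 2 + ‖W‖ ^ 2 := by rw [hM]; field_simp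
    have h3 : (‖W‖ * (1 + t ^ 2 * M)) ^ 2 =
        ‖W‖ ^ 2 + 2 * t ^ 2 * (M * ‖W‖ ^ 2) + (t ^ 2 * M * ‖W‖) ^ 2 := by ring
    rw [h3, hMN] at hsq
    have h4 : 0 < t ^ 2 * ‖W‖ ^ 2 := by positivity
    have h5 : 0 ≤ t ^ 2 * ‖d‖ ^ 2 := by positivity
    nlinarith [sq_nonneg (t ^ 2 * M * ‖W‖)]
  set A : Set (ι → ℝ) := stdSimplex ℝ ι ∩ {b | ∀ i, i ∉ S → b i = 0} with hA
  let T : (ι → ℝ) →ₗ[ℝ] E := ∑ i, (LinearMap.proj i : (ι → ℝ) →ₗ[ℝ] ℝ).smulRight (G i)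
  have hT : ∀ b, T b = ∑ i, b i • G i := fun b => by simp [T]
  have hTc : Continuous T := T.continuous_of_finiteDimensional
  have hAc : IsCompact A := (isCompact_stdSimplex ℝ ι).inter_right <| by
    simp only [Set.ofPred_forall]
    exact isClosed_iInter fun i => isClosed_iInter fun _ =>
      isClosed_eq (continuous_apply i) continuous_const
  have hAconv : Convex ℝ A := (convex_stdSimplex ℝ ι).inter <| by
    intro b hb b' hb' s t _ _ _ i hi
    simp [hb i hi, hb' i hi]
  -- The normalized `W` and the active gradients all have inner product `1` with `W`. A functional
  -- separating `W` from their convex hull, once its `W`-component is removed, would improve every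
  -- active margin.
  have hmem : (‖W‖ ^ 2)⁻¹ • W ∈ T '' A := by
    by_contra hnot
    obtain ⟨f, u, hfu, huf⟩ := geometric_hahn_banach_point_closed
      (hAconv.linear_image T) (hAc.image hTc).isClosed hnot
    set d₀ := (InnerProductSpace.toDual ℝ E).symm f with hd₀
    have hf : ∀ v, f v = inner ℝ d₀ v := fun v => by
      rw [hd₀, InnerProductSpace.toDual_symm_apply]
    set k := inner ℝ W d₀ / ‖W‖ ^ 2 with hk
    obtain ⟨i, hi, hle⟩ := noDescent (d₀ - k • W) (by
      rw [inner_sub_right, real_inner_smul_right, real_inner_self_eq_norm_sq, hk]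
      field_simp
      ring)
    rw [inner_sub_right, real_inner_smul_right, hGW i hi, mul_one] at hle
    have h1 : u < f (G i) := huf _ ⟨Pi.single i 1, ⟨single_mem_stdSimplex ℝ i, fun j hj => by
      rw [Pi.single_eq_of_ne]; rintro rfl; exact hj hi⟩, by
        rw [hT, Finset.sum_eq_single i]
        · simp
        · intro j _ hj; simp [hj]
        · simp⟩
    rw [hf, real_inner_smul_right, real_inner_comm, inv_mul_eq_div, ← hk] at hfu
    rw [hf, real_inner_comm] at h1
    linarith
  obtain ⟨b, ⟨⟨hb0, hb1⟩, hbS⟩, hb⟩ := hmem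
  rw [hT] at hb
  refine ⟨fun i => ‖W‖ ^ 2 * b i, fun i => mul_nonneg (by positivity) (hb0 i), hfeas,
    fun i => ?_, ?_⟩
  · by_cases hi : i ∈ S
    · rw [(Finset.mem_filter.1 hi).2]; ring
    · rw [hbS i hi]; ring
  · simp_rw [mul_smul, ← Finset.smul_sum]
    rw [hb, smul_smul, mul_inv_cancel₀ (by positivity), one_smul]

end Margin

section Complementarity

open MeasureTheory

variable {E : Type*} [NormedAddCommGroup E] [InnerProductSpace ℝ E]

/-! ### Strict complementarity for almost every dataset -/

theorem ae_inner_ne [FiniteDimensional ℝ E] [MeasurableSpace E] [BorelSpace E] (ν : Measure E)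
    [ν.IsAddHaarMeasure] {w : E} (hw : w ≠ 0) (k : ℝ) : ∀ᵐ v ∂ν, inner ℝ w v ≠ k := by
  have hs : MeasurableSet {v : E | inner ℝ w v ≠ k} :=
    (isClosed_eq (by fun_prop) continuous_const).measurableSet.compl
  refine ae_mem_of_ae_add_linearMap_mem (LinearMap.toSpanSingleton ℝ E w) volume ν hs fun v => ?_
  have hfin : (Set.Finite {t : ℝ | inner ℝ w (v + t • w) = k}) := by
    refine Set.Subsingleton.finite fun t ht t' ht' => ?_
    simp only [Set.mem_ofPred_eq, inner_add_right, real_inner_smul_right] at ht ht'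
    have : inner ℝ w w ≠ 0 := inner_self_ne_zero.2 hw
    exact mul_right_cancel₀ this (by linarith)
  filter_upwards [(measure_eq_zero_iff_ae_notMem.1 (hfin.measure_zero volume))] with t ht
  exact ht

/-- The robust Karush–Kuhn–Tucker conditions, in a form that is closed in all the variables,
together with tightness of the constraint `j` and vanishing of its multiplier. -/
structure IsDegenerateKKT {ι : Type*} [Fintype ι] (z : ι → E) (e : ι → ℝ) (j : ι) (W : E)
    (α : ι → ℝ) : Prop where
  nonneg : ∀ i, 0 ≤ α i
  feasible : ∀ i, 1 ≤ robustMargin (z i) (e i) W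
  slack : ∀ i, α i * (robustMargin (z i) (e i) W - 1) = 0
  stationary : ‖W‖ • W = ∑ i, α i • (‖W‖ • z i - e i • W)
  mult_eq_zero : α j = 0
  margin_eq_one : robustMargin (z j) (e j) W = 1

theorem IsDegenerateKKT.ne_zero {ι : Type*} [Fintype ι] {z : ι → E} {e : ι → ℝ} {j : ι} {W : E}
    {α : ι → ℝ} (h : IsDegenerateKKT z e j W α) : W ≠ 0 := by
  rintro rfl
  have := h.margin_eq_one
  simp [robustMargin] at this

theorem IsRobustKKT.isDegenerateKKT {ι : Type*} [Fintype ι] {z : ι → E} {e : ι → ℝ} {j : ι} {W : E}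
    {α : ι → ℝ} (h : IsRobustKKT z e W α) (h0 : α j = 0)
    (h1 : robustMargin (z j) (e j) W = 1) : IsDegenerateKKT z e j W α := by
  refine ⟨h.nonneg, h.feasible, h.slack, ?_, h0, h1⟩
  have hW : ‖W‖ ≠ 0 := by
    rw [norm_ne_zero_iff]; rintro rfl; simp [robustMargin] at h1
  have h2 : ‖W‖ • W = ‖W‖ • ∑ i, α i • marginGrad (z i) (e i) W := congrArg _ h.stationary
  rw [h2, Finset.smul_sum]
  refine Finset.sum_congr rfl fun i _ => ?_
  rw [smul_comm, marginGrad, smul_sub, smul_comm _ (e i), smul_smul ‖W‖ ‖W‖⁻¹ W,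
    mul_inv_cancel₀ hW, one_smul]

/-- The vector in a degenerate solution depends only on the data of the other constraints. -/
theorem IsDegenerateKKT.unique {ι : Type*} [Fintype ι] {z z' : ι → E} {e : ι → ℝ} {j : ι}
    {W W' : E} {α α' : ι → ℝ} (he : ∀ i, 0 ≤ e i) (h : IsDegenerateKKT z e j W α)
    (h' : IsDegenerateKKT z' e j W' α') (hz : ∀ i, i ≠ j → z i = z' i) : W = W' := by
  -- Pair stationarity of `W` with the feasibility of `W'`. Constraint `j`, the only one that
  -- differs, drops out because its multiplier vanishes. Exchanging the roles then gives `‖W - W'‖ ^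
  -- 2 ≤ 0`.
  have key : ∀ {z z' : ι → E} {W W' : E} {α α' : ι → ℝ}, IsDegenerateKKT z e j W α →
      IsDegenerateKKT z' e j W' α' → (∀ i, i ≠ j → z i = z' i) → ‖W‖ ^ 2 ≤ inner ℝ W W' := by
    intro z z' W W' α α' h h' hz
    have hW : 0 < ‖W‖ := norm_pos_iff.2 h.ne_zero
    have h1 : ∀ v, ‖W‖ * inner ℝ W v =
        ∑ i, α i * (‖W‖ * inner ℝ (z i) v - e i * inner ℝ W v) := fun v => by
      rw [← real_inner_smul_left, h.stationary, sum_inner]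
      simp_rw [real_inner_smul_left, inner_sub_left, real_inner_smul_left]
    refine le_of_mul_le_mul_left ?_ hW
    have h2 : ‖W‖ * ‖W‖ ^ 2 = ∑ i, α i * ‖W‖ := by
      rw [← real_inner_self_eq_norm_sq, h1]
      refine Finset.sum_congr rfl fun i _ => ?_
      have := h.slack i
      rw [robustMargin] at this
      rw [real_inner_self_eq_norm_sq]
      linear_combination ‖W‖ * this
    rw [h1, h2]
    refine Finset.sum_le_sum fun i _ => ?_
    rcases eq_or_ne i j with rfl | hij
    · rw [h.mult_eq_zero]; simp
    · refine mul_le_mul_of_nonneg_left ?_ (h.nonneg i)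
      have h3 := h'.feasible i
      rw [robustMargin, ← hz i hij] at h3
      have h4 := mul_le_mul_of_nonneg_left (real_inner_le_norm W W') (he i)
      nlinarith
  have h1 := key h h' hz
  have h2 := key h' h fun i hi => (hz i hi).symm
  have h3 := norm_sub_sq_real W W'
  rw [real_inner_comm] at h2
  have h4 : ‖W - W'‖ ^ 2 ≤ 0 := by linarith
  have h5 : ‖W - W'‖ = 0 := by nlinarith [norm_nonneg (W - W'), sq_nonneg ‖W - W'‖]
  exact sub_eq_zero.1 (norm_eq_zero.1 h5)

/-- With the other points fixed, a degenerate solution at `j` has a vector `W` that does not depend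
on `x j`, and tightness places `x j` on a fixed hyperplane. A Fubini argument in the coordinate `j`
makes such datasets null. -/
theorem ae_strict_complementarity [FiniteDimensional ℝ E] [MeasurableSpace E] [BorelSpace E]
    {ι : Type*} [Fintype ι] (ν : Measure (ι → E)) [ν.IsAddHaarMeasure] (e y : ι → ℝ)
    (he : ∀ i, 0 ≤ e i) (hy : ∀ i, y i ≠ 0) :
    ∀ᵐ x ∂ν, ∀ W α, IsRobustKKT (fun i => y i • x i) e W α →
      ∀ j, robustMargin (y j • x j) (e j) W = 1 → 0 < α j := by
  classical
  have key : ∀ j, ∀ᵐ x ∂ν, x ∈ {x | ∃ q : E × (ι → ℝ),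
      IsDegenerateKKT (fun i => y i • x i) e j q.1 q.2}ᶜ := by
    intro j
    refine ae_mem_of_ae_add_linearMap_mem (LinearMap.single ℝ (fun _ => E) j)
      (Measure.addHaar : Measure E) ν ?_ ?_
    -- Measurability: the bad set is the projection of a closed subset of a finite-dimensional
    -- space, hence a countable union of compact sets.
    · have hC : IsClosed {p : (ι → E) × (E × (ι → ℝ)) |
          IsDegenerateKKT (fun i => y i • p.1 i) e j p.2.1 p.2.2} := by
        have : {p : (ι → E) × (E × (ι → ℝ)) |
          IsDegenerateKKT (fun i => y i • p.1 i) e j p.2.1 p.2.2} =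
          {p | ∀ i, 0 ≤ p.2.2 i} ∩ {p | ∀ i, 1 ≤ robustMargin (y i • p.1 i) (e i) p.2.1} ∩
          {p | ∀ i, p.2.2 i * (robustMargin (y i • p.1 i) (e i) p.2.1 - 1) = 0} ∩
          {p | ‖p.2.1‖ • p.2.1 = ∑ i, p.2.2 i • (‖p.2.1‖ • (y i • p.1 i) - e i • p.2.1)} ∩
          {p | p.2.2 j = 0} ∩ {p | robustMargin (y j • p.1 j) (e j) p.2.1 = 1} := by
          ext p
          exact ⟨fun ⟨a, b, c, d, f, g⟩ => ⟨⟨⟨⟨⟨a, b⟩, c⟩, d⟩, f⟩, g⟩,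
            fun ⟨⟨⟨⟨⟨a, b⟩, c⟩, d⟩, f⟩, g⟩ => ⟨a, b, c, d, f, g⟩⟩
        rw [this]
        unfold robustMargin
        simp only [Set.ofPred_forall]
        refine ((((IsClosed.inter ?_ ?_).inter ?_).inter ?_).inter ?_).inter ?_
        · exact isClosed_iInter fun i => isClosed_le (by fun_prop) (by fun_prop)
        · exact isClosed_iInter fun i => isClosed_le (by fun_prop) (by fun_prop)
        · exact isClosed_iInter fun i => isClosed_eq (by fun_prop) (by fun_prop)
        · exact isClosed_eq (by fun_prop) (by fun_prop)
        · exact isClosed_eq (by fun_prop) (by fun_prop)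
        · exact isClosed_eq (by fun_prop) (by fun_prop)
      have hσ : IsSigmaCompact (Prod.fst '' {p : (ι → E) × (E × (ι → ℝ)) |
          IsDegenerateKKT (fun i => y i • p.1 i) e j p.2.1 p.2.2}) :=
        (isSigmaCompact_univ.of_isClosed_subset hC (Set.subset_univ _)).image continuous_fst
      have himage : {x | ∃ q : E × (ι → ℝ), IsDegenerateKKT (fun i => y i • x i) e j q.1 q.2} =
          Prod.fst '' {p : (ι → E) × (E × (ι → ℝ)) |
          IsDegenerateKKT (fun i => y i • p.1 i) e j p.2.1 p.2.2} := by
        ext x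
        simp
      obtain ⟨K, hK, hKU⟩ := hσ
      rw [himage, ← hKU]
      exact (MeasurableSet.iUnion fun k => (hK k).measurableSet).compl
    · intro x
      by_cases hex : ∃ ξ₀ : E, ∃ q : E × (ι → ℝ),
          IsDegenerateKKT (fun i => y i • (x + LinearMap.single ℝ (fun _ => E) j ξ₀ : ι → E) i) e j q.1 q.2
      · obtain ⟨ξ₀, ⟨W₀, α₀⟩, h₀⟩ := hex
        filter_upwards [ae_inner_ne (Measure.addHaar : Measure E) h₀.ne_zero
          ((1 + e j * ‖W₀‖) / y j - inner ℝ W₀ (x j))] with ξ hξ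
        rintro ⟨⟨W, α⟩, h⟩
        have hWW := IsDegenerateKKT.unique he h h₀ (fun i hi => by
          simp [Pi.single_eq_of_ne hi])
        simp only at hWW
        refine hξ ?_
        have h1 := h.margin_eq_one
        simp only [hWW, robustMargin, LinearMap.single_apply, Pi.add_apply, Pi.single_eq_same,
          real_inner_smul_left, inner_add_left] at h1
        rw [eq_sub_iff_add_eq, eq_div_iff (hy j)]
        linear_combination h1 + y j * real_inner_comm (x j) W₀ + y j * real_inner_comm ξ W₀
      · push Not at hex
        exact Filter.Eventually.of_forall fun ξ ⟨q, hq⟩ => hex ξ q hq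
  filter_upwards [ae_all_iff.2 key] with x hx W α h j hj
  refine lt_of_le_of_ne (h.nonneg j) fun h0 => hx j ⟨(W, α), h.isDegenerateKKT h0.symm hj⟩

/-! ### The offset of the limiting ray. -/

/-- Under strict complementarity, the exponential weights of the active constraints along the ray
through `W` can be matched to the multipliers by a translation within the span of the active
gradients. -/
theorem exists_offset {ι : Type*} [Fintype ι] {z : ι → E} {e α : ι → ℝ} {W : E} (hW : W ≠ 0)
    (h : IsRobustKKT z e W α)
    (hstrict : ∀ α', IsRobustKKT z e W α' → ∀ j, robustMargin (z j) (e j) W = 1 → 0 < α' j)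
    {a : ℝ} (ha : 0 < a) :
    ∃ (v : E) (c : ι → ℝ) (Θ : ℝ), 0 < Θ ∧ inner ℝ W v = 0 ∧
      v = ∑ i, c i • marginGrad (z i) (e i) W ∧
      (∀ i, robustMargin (z i) (e i) W ≠ 1 → c i = 0) ∧
      ∀ i, robustMargin (z i) (e i) W = 1 →
        exp (-a * inner ℝ (marginGrad (z i) (e i) W) v) = Θ * α i := by
  classical
  set G : ι → E := fun i => marginGrad (z i) (e i) W with hG
  have hGW : ∀ i, inner ℝ (G i) W = robustMargin (z i) (e i) W := fun i =>
    inner_marginGrad_self _ _ _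
  have hα0 : ∀ i, robustMargin (z i) (e i) W ≠ 1 → α i = 0 := fun i hi =>
    (mul_eq_zero.1 (h.slack i)).resolve_right (sub_ne_zero.2 hi)
  -- A nontrivial relation among the active gradients has coefficient sum zero (pair with `W`),
  -- hence a negative coefficient. Adding the multiple at which the first multiplier vanishes yields
  -- new multipliers that violate `hstrict`, which is why it covers all of them.
  have hindep : ∀ c : ι → ℝ, (∀ i, robustMargin (z i) (e i) W ≠ 1 → c i = 0) →
      ∑ i, c i • G i = 0 → c = 0 := by
    intro c hc hsum
    by_contra hne
    have hsum0 : ∑ i, c i = 0 := by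
      have h1 : inner ℝ (∑ i, c i • G i) W = 0 := by rw [hsum, inner_zero_left]
      rw [sum_inner] at h1
      rw [← h1]
      refine Finset.sum_congr rfl fun i _ => ?_
      rw [real_inner_smul_left, hGW]
      by_cases hi : robustMargin (z i) (e i) W = 1
      · rw [hi, mul_one]
      · rw [hc i hi, zero_mul]
    have hneg : ∃ i, c i < 0 := by
      by_contra! hpos
      refine hne (funext fun i => ?_)
      exact (Finset.sum_eq_zero_iff_of_nonneg fun i _ => hpos i).1 hsum0 i (Finset.mem_univ _)
    obtain ⟨i₀, hi₀⟩ := hneg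
    obtain ⟨j, hj, hmin⟩ := (Finset.univ.filter fun i => c i < 0).exists_min_image
      (fun i => α i / (-c i)) ⟨i₀, by simpa using hi₀⟩
    have hcj : c j < 0 := by simpa using hj
    set t := α j / (-c j) with ht
    have ht0 : 0 ≤ t := div_nonneg (h.nonneg j) (by linarith)
    have hjS : robustMargin (z j) (e j) W = 1 := by
      by_contra hj'
      exact hcj.ne (hc j hj')
    have hnew : IsRobustKKT z e W (fun i => α i + t * c i) := by
      refine ⟨fun i => ?_, h.feasible, fun i => ?_, ?_⟩
      · rcases lt_or_ge (c i) 0 with hi | hi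
        · have := hmin i (by simpa using hi)
          rw [le_div_iff₀ (by linarith)] at this
          linarith
        · have := h.nonneg i
          positivity
      · by_cases hi : robustMargin (z i) (e i) W = 1
        · rw [hi]; ring
        · rw [hc i hi, mul_zero, add_zero]; exact h.slack i
      · simp_rw [add_smul, mul_smul, Finset.sum_add_distrib, ← Finset.smul_sum]
        rw [hsum, smul_zero, add_zero]
        exact h.stationary
    have := hstrict _ hnew j hjS
    have h0 : α j + t * c j = 0 := by
      rw [ht, div_mul_eq_mul_div, div_neg, mul_div_cancel_right₀ _ hcj.ne]; ring
    exact this.ne' h0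
  let P : (ι → ℝ) →ₗ[ℝ] E := ∑ i, if robustMargin (z i) (e i) W = 1 then
    (LinearMap.proj i : (ι → ℝ) →ₗ[ℝ] ℝ).smulRight (G i) else 0
  have hP : ∀ c, P c = ∑ i, (if robustMargin (z i) (e i) W = 1 then c i else 0) • G i := by
    intro c
    simp only [P, LinearMap.sum_apply]
    refine Finset.sum_congr rfl fun i _ => ?_
    split_ifs <;> simp
  -- The Gram map on active coordinates and the identity on the others: independence makes it
  -- injective, hence surjective.
  let T : (ι → ℝ) →ₗ[ℝ] (ι → ℝ) := LinearMap.pi fun i =>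
    if robustMargin (z i) (e i) W = 1 then (innerₗ E (G i)).comp P else LinearMap.proj i
  have hT : ∀ c i, T c i = if robustMargin (z i) (e i) W = 1 then inner ℝ (G i) (P c) else c i := by
    intro c i
    simp only [T, LinearMap.pi_apply]
    split_ifs <;> simp
  have hTinj : Function.Injective T := by
    rw [← LinearMap.ker_eq_bot, LinearMap.ker_eq_bot']
    intro c hc
    have hc' : ∀ i, T c i = 0 := fun i => by rw [hc]; rfl
    have hoff : ∀ i, robustMargin (z i) (e i) W ≠ 1 → c i = 0 := fun i hi => by
      have := hc' i
      rwa [hT, if_neg hi] at this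
    have hPc : P c = ∑ i, c i • G i := by
      rw [hP]
      refine Finset.sum_congr rfl fun i _ => ?_
      split_ifs with hi
      · rfl
      · rw [hoff i hi]
    refine hindep c hoff ?_
    rw [← hPc, ← inner_self_eq_zero (𝕜 := ℝ)]
    conv_lhs => rw [hPc, sum_inner]
    refine Finset.sum_eq_zero fun i _ => ?_
    rw [← hPc, real_inner_smul_left]
    by_cases hi : robustMargin (z i) (e i) W = 1
    · have := hc' i
      rw [hT, if_pos hi] at this
      rw [this, mul_zero]
    · rw [hoff i hi, zero_mul]
  obtain ⟨c, hc⟩ := LinearMap.injective_iff_surjective.1 hTinj fun i => -log (α i) / a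
  set k := inner ℝ W (P c) / ‖W‖ ^ 2 with hk
  have hN : ‖W‖ ≠ 0 := norm_ne_zero_iff.2 hW
  -- Removing the `W`-component lowers every active product `⟪G i, ·⟫` by the same `k`, so the
  -- weights only gain the common factor `exp (a * k)`. By stationarity `W` is itself a combination
  -- of active gradients.
  refine ⟨P c - k • W,
    fun i => (if robustMargin (z i) (e i) W = 1 then c i else 0) - k * α i, exp (a * k),
    exp_pos _, ?_, ?_, fun i hi => ?_, fun i hi => ?_⟩
  · rw [inner_sub_right, real_inner_smul_right, real_inner_self_eq_norm_sq, hk]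
    field_simp
    ring
  · simp_rw [sub_smul, mul_smul, Finset.sum_sub_distrib, ← Finset.smul_sum]
    rw [← h.stationary, hP]
  · simp [hi, hα0 i hi]
  · have h1 := congrFun hc i
    rw [hT, if_pos hi] at h1
    have hGi : marginGrad (z i) (e i) W = G i := rfl
    rw [hGi, inner_sub_right, real_inner_smul_right, hGW, hi, h1]
    have hpos := hstrict α h i hi
    have : -a * (-log (α i) / a - k * 1) = a * k + log (α i) := by field_simp; ring
    rw [this, exp_add, exp_log hpos]

end Complementarity

section Dynamics

variable {E : Type*} [NormedAddCommGroup E] [InnerProductSpace ℝ E] {ι : Type*} [Fintype ι]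

/-! ### Gradient descent on losses of robust margins -/

/-- The negative gradient of the sum of losses of robust margins, where `r` is the negative of the
derivative of the loss. -/
noncomputable def marginForce (z : ι → E) (e : ι → ℝ) (r : ℝ → ℝ) (w : E) : E :=
  ∑ i, r (robustMargin (z i) (e i) w) • marginGrad (z i) (e i) w

variable {z : ι → E} {e : ι → ℝ} {r : ℝ → ℝ}

theorem inner_marginForce (w v : E) : inner ℝ (marginForce z e r w) v =
    ∑ i, r (robustMargin (z i) (e i) w) * inner ℝ (marginGrad (z i) (e i) w) v := by
  rw [marginForce, sum_inner]
  simp_rw [real_inner_smul_left]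

theorem sum_rate_le_inner_marginForce (he : ∀ i, 0 ≤ e i) (hr : ∀ u, 0 ≤ r u) {W : E}
    (hW : ∀ i, 1 ≤ robustMargin (z i) (e i) W) (w : E) :
    ∑ i, r (robustMargin (z i) (e i) w) ≤ inner ℝ (marginForce z e r w) W := by
  rw [inner_marginForce]
  refine Finset.sum_le_sum fun i _ => ?_
  exact le_mul_of_one_le_right (hr _)
    ((hW i).trans (robustMargin_le_inner_marginGrad _ (he i) _ _))

/-- The operator `b ↦ ∑ b i • G i` and its adjoint satisfy the same norm bound. -/
theorem sum_sq_inner_marginGrad_le {S : ℝ} {w : E}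
    (hS : ∀ b : ι → ℝ, ‖∑ i, b i • marginGrad (z i) (e i) w‖ ^ 2 ≤ S ^ 2 * ∑ i, b i ^ 2) (d : E) :
    ∑ i, inner ℝ (marginGrad (z i) (e i) w) d ^ 2 ≤ S ^ 2 * ‖d‖ ^ 2 := by
  set b : ι → ℝ := fun i => inner ℝ (marginGrad (z i) (e i) w) d with hb
  set Q := ∑ i, b i ^ 2 with hQ
  have hQ0 : 0 ≤ Q := Finset.sum_nonneg fun i _ => sq_nonneg _
  have h1 : Q = inner ℝ (∑ i, b i • marginGrad (z i) (e i) w) d := by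
    rw [sum_inner]
    refine Finset.sum_congr rfl fun i _ => ?_
    rw [real_inner_smul_left, sq]
  have h2 : Q ^ 2 ≤ S ^ 2 * Q * ‖d‖ ^ 2 := by
    have h3 : Q ≤ ‖∑ i, b i • marginGrad (z i) (e i) w‖ * ‖d‖ := by
      conv_lhs => rw [h1]
      exact real_inner_le_norm _ _
    calc Q ^ 2 ≤ (‖∑ i, b i • marginGrad (z i) (e i) w‖ * ‖d‖) ^ 2 := by gcongr
      _ = ‖∑ i, b i • marginGrad (z i) (e i) w‖ ^ 2 * ‖d‖ ^ 2 := by ring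
      _ ≤ _ := by gcongr; exact hS b
  rcases hQ0.eq_or_lt with h | h
  · rw [← h]; positivity
  · refine le_of_mul_le_mul_left ?_ h
    linarith [h2, sq Q]

theorem norm_sq_add_smul_marginForce_le {S η K : ℝ} (hη : 0 ≤ η)
    (hK : ∀ u, 2 * (r u * u) + η * S ^ 2 * r u ^ 2 ≤ K) {w : E}
    (hS : ∀ b : ι → ℝ, ‖∑ i, b i • marginGrad (z i) (e i) w‖ ^ 2 ≤ S ^ 2 * ∑ i, b i ^ 2) :
    ‖w + η • marginForce z e r w‖ ^ 2 ≤ ‖w‖ ^ 2 + η * (Fintype.card ι * K) := by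
  have h1 : ‖marginForce z e r w‖ ^ 2 ≤ S ^ 2 * ∑ i, r (robustMargin (z i) (e i) w) ^ 2 :=
    hS _
  have h2 : inner ℝ w (marginForce z e r w) =
      ∑ i, r (robustMargin (z i) (e i) w) * robustMargin (z i) (e i) w := by
    rw [real_inner_comm, inner_marginForce]
    simp_rw [inner_marginGrad_self]
  have h3 : ∑ i, (2 * (r (robustMargin (z i) (e i) w) * robustMargin (z i) (e i) w) +
      η * S ^ 2 * r (robustMargin (z i) (e i) w) ^ 2) ≤ Fintype.card ι * K := by
    refine (Finset.sum_le_sum fun i _ => hK _).trans_eq ?_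
    simp
  rw [Finset.sum_add_distrib, ← Finset.mul_sum, ← Finset.mul_sum, ← h2] at h3
  rw [norm_add_sq_real, real_inner_smul_right, norm_smul, Real.norm_of_nonneg hη, mul_pow]
  nlinarith [mul_le_mul_of_nonneg_left h3 hη, mul_le_mul_of_nonneg_left h1 (sq_nonneg η)]

/-- Along gradient descent the total slope of the loss becomes arbitrarily small. -/
theorem exists_sum_rate_lt {S η K : ℝ} (hη : 0 < η) (he : ∀ i, 0 ≤ e i) (hr : ∀ u, 0 ≤ r u)
    (hK : ∀ u, 2 * (r u * u) + η * S ^ 2 * r u ^ 2 ≤ K)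
    (hS : ∀ w, ∀ b : ι → ℝ, ‖∑ i, b i • marginGrad (z i) (e i) w‖ ^ 2 ≤ S ^ 2 * ∑ i, b i ^ 2)
    {W : E} (hW : ∀ i, 1 ≤ robustMargin (z i) (e i) W) {w : ℕ → E}
    (hw : ∀ t, w (t + 1) = w t + η • marginForce z e r (w t)) {δ : ℝ} (hδ : 0 < δ) :
    ∃ t, ∑ i, r (robustMargin (z i) (e i) (w t)) < δ := by
  by_contra! hcon
  set K' := |η * (Fintype.card ι * K)| with hK'
  -- Linear growth along `W` is incompatible, by Cauchy–Schwarz, with `‖w t‖ = O(√t)` from `hsq`.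
  have hlin : ∀ t : ℕ, inner ℝ (w 0) W + η * δ * t ≤ inner ℝ (w t) W := by
    intro t
    induction t with
    | zero => simp
    | succ t ih =>
      have h1 := (hcon t).trans (sum_rate_le_inner_marginForce he hr hW (w t))
      rw [hw t, inner_add_left, real_inner_smul_left]
      push_cast
      nlinarith
  have hsq : ∀ t : ℕ, ‖w t‖ ^ 2 ≤ ‖w 0‖ ^ 2 + K' * t := by
    intro t
    induction t with
    | zero => simp
    | succ t ih =>
      have h1 := norm_sq_add_smul_marginForce_le hη.le hK (hS (w t))
      rw [← hw t] at h1
      have h2 := le_abs_self (η * (Fintype.card ι * K))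
      push_cast
      linarith
  set b := η * δ with hb
  have hbpos : 0 < b := mul_pos hη hδ
  set A := inner ℝ (w 0) W with hA
  obtain ⟨t, ht⟩ := exists_nat_gt
    (max 1 (max (2 * |A| / b) (4 * (‖W‖ ^ 2 * (‖w 0‖ ^ 2 + K')) / b ^ 2)))
  simp only [max_lt_iff] at ht
  obtain ⟨ht1, ht2, ht3⟩ := ht
  rw [div_lt_iff₀ hbpos] at ht2
  rw [div_lt_iff₀ (by positivity)] at ht3
  have hlow : b * t / 2 ≤ ‖w t‖ * ‖W‖ := by
    refine le_trans ?_ ((hlin t).trans (real_inner_le_norm _ _))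
    linarith [neg_abs_le A]
  have hlow2 : (b * t / 2) ^ 2 ≤ (‖w 0‖ ^ 2 + K' * t) * ‖W‖ ^ 2 := by
    calc (b * t / 2) ^ 2 ≤ (‖w t‖ * ‖W‖) ^ 2 := by gcongr
      _ = ‖w t‖ ^ 2 * ‖W‖ ^ 2 := by ring
      _ ≤ _ := by gcongr; exact hsq t
  have hup : (‖w 0‖ ^ 2 + K' * t) * ‖W‖ ^ 2 ≤ ‖W‖ ^ 2 * (‖w 0‖ ^ 2 + K') * t := by
    have : ‖w 0‖ ^ 2 ≤ ‖w 0‖ ^ 2 * t := le_mul_of_one_le_right (sq_nonneg _) ht1.le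
    nlinarith [sq_nonneg ‖W‖]
  have : (t : ℝ) * (t * b ^ 2) ≤ 4 * (‖W‖ ^ 2 * (‖w 0‖ ^ 2 + K')) * t := by nlinarith
  nlinarith

/-- Far from the origin and on correctly classified data, a step of gradient descent decreases the
loss. -/
theorem exists_descent {S η R₀ : ℝ} {β : NNReal} {ℓ : ℝ → ℝ} (hℓ : Differentiable ℝ ℓ)
    (hanti : Antitone ℓ) (hlip : LipschitzWith β (deriv ℓ)) (hη : 0 < η)
    (hηβ : η * (β * S ^ 2) < 2) (he : ∀ i, 0 ≤ e i) (hr : ∀ u, 0 ≤ -deriv ℓ u)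
    (hR : ∀ u, 0 ≤ u → -deriv ℓ u ≤ R₀)
    (hS : ∀ w, ∀ b : ι → ℝ, ‖∑ i, b i • marginGrad (z i) (e i) w‖ ^ 2 ≤ S ^ 2 * ∑ i, b i ^ 2) :
    ∃ M κ : ℝ, 0 < M ∧ 0 < κ ∧ ∀ w d : E,
      d = η • marginForce z e (fun u => -deriv ℓ u) w →
      (∀ i, 0 ≤ robustMargin (z i) (e i) w) → M ≤ ‖w‖ →
      ∑ i, ℓ (robustMargin (z i) (e i) (w + d)) + κ * ‖d‖ ^ 2 ≤
        ∑ i, ℓ (robustMargin (z i) (e i) w) := by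
  -- The descent coefficient for linear margins. Half of it pays for the Young splitting with
  -- parameter `θ`, a quarter for the curvature of the norm once `‖w‖ ≥ M`, and the last quarter is
  -- `κ`.
  set gap := 1 / η - β * S ^ 2 / 2 with hgap
  have hgap0 : 0 < gap := by
    rw [hgap, sub_pos, div_lt_div_iff₀ two_pos hη]; linarith
  have hR0 : 0 ≤ R₀ := (hr 0).trans (hR 0 le_rfl)
  set θ := gap / (β * S ^ 2 + 1) with hθ
  have hβ0 : (0 : ℝ) ≤ β := β.2
  have hθ0 : 0 < θ := by positivity
  have hθS : β * S ^ 2 * θ ≤ gap := by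
    rw [hθ, mul_div_assoc', div_le_iff₀ (by positivity)]; nlinarith
  set A := ∑ i, e i ^ 2 with hA
  set B := ∑ i, e i with hB
  have hA0 : 0 ≤ A := Finset.sum_nonneg fun i _ => sq_nonneg _
  have hB0 : 0 ≤ B := Finset.sum_nonneg fun i _ => he i
  set D := η ^ 2 * (S ^ 2 * (Fintype.card ι * R₀ ^ 2)) with hD
  have hD0 : 0 ≤ D := by positivity
  set C := R₀ * B / 2 + β / 2 * (1 + 1 / θ) * A * D / 4 with hC
  have hC0 : 0 ≤ C := by positivity
  refine ⟨1 + 4 * C / gap, gap / 4, by positivity, by positivity, fun w d hd hu hM => ?_⟩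
  have hM1 : 1 ≤ ‖w‖ := le_trans (by simpa using by positivity) hM
  have hCw : C / ‖w‖ ≤ gap / 4 := by
    rw [div_le_iff₀ (by positivity)]
    have : gap / 4 * (1 + 4 * C / gap) = gap / 4 + C := by field_simp
    nlinarith
  have hw0 : w ≠ 0 := by
    rintro rfl; rw [norm_zero] at hM1; linarith
  have hwpos : 0 < ‖w‖ := by linarith
  set u : ι → ℝ := fun i => robustMargin (z i) (e i) w with hu_def
  set g : ι → ℝ := fun i => inner ℝ (marginGrad (z i) (e i) w) d with hg
  set ρ : ι → ℝ := fun i => -deriv ℓ (u i) with hρ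
  have hdD : ‖d‖ ^ 2 ≤ D := by
    rw [hd, norm_smul, mul_pow, Real.norm_of_nonneg hη.le, hD]
    have h1 : ‖marginForce z e (fun u => -deriv ℓ u) w‖ ^ 2 ≤ S ^ 2 * ∑ i, ρ i ^ 2 := hS w _
    have h2 : ∑ i, ρ i ^ 2 ≤ Fintype.card ι * R₀ ^ 2 := by
      refine (Finset.sum_le_sum fun i _ => pow_le_pow_left₀ (hr _) (hR _ (hu i)) 2).trans_eq ?_
      simp
    gcongr
    exact h1.trans (by gcongr)
  have hforce : ∑ i, ρ i * g i = ‖d‖ ^ 2 / η := by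
    have h1 : ∑ i, ρ i * g i = inner ℝ (marginForce z e (fun u => -deriv ℓ u) w) d :=
      by rw [inner_marginForce]
    have h2 : inner ℝ d d = η * inner ℝ (marginForce z e (fun u => -deriv ℓ u) w) d := by
      conv_lhs => rw [hd, real_inner_smul_left, ← hd]
    rw [h1, eq_div_iff hη.ne', ← real_inner_self_eq_norm_sq, h2, mul_comm]
  have hg2 : ∑ i, g i ^ 2 ≤ S ^ 2 * ‖d‖ ^ 2 := sum_sq_inner_marginGrad_le (hS w) d
  set k := ‖d‖ ^ 2 / (2 * ‖w‖) with hk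
  have hk0 : 0 ≤ k := by positivity
  have hterm : ∀ i, ℓ (robustMargin (z i) (e i) (w + d)) ≤ ℓ (u i) - ρ i * g i + R₀ * k * e i +
      β / 2 * ((1 + θ) * g i ^ 2 + (1 + 1 / θ) * (k ^ 2 * e i ^ 2)) := by
    intro i
    have h1 : u i + (g i - e i * k) ≤ robustMargin (z i) (e i) (w + d) := by
      have := robustMargin_add_ge (z i) (he i) hw0 d
      linarith
    have h2 := le_quadratic_of_lipschitzWith_deriv hℓ hlip (u i) (u i + (g i - e i * k))
    rw [add_sub_cancel_left] at h2
    have h3 : deriv ℓ (u i) * (g i - e i * k) = -(ρ i * g i) + ρ i * (k * e i) := by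
      rw [hρ]; ring
    have h4 : ρ i * (k * e i) ≤ R₀ * (k * e i) :=
      mul_le_mul_of_nonneg_right (hR _ (hu i)) (mul_nonneg hk0 (he i))
    have h5 : (g i - e i * k) ^ 2 ≤ (1 + θ) * g i ^ 2 + (1 + 1 / θ) * (k ^ 2 * e i ^ 2) := by
      have : (1 + θ) * g i ^ 2 + (1 + 1 / θ) * (k ^ 2 * e i ^ 2) - (g i - e i * k) ^ 2 =
          (θ * g i + e i * k) ^ 2 / θ := by
        field_simp; ring
      have h6 : 0 ≤ (θ * g i + e i * k) ^ 2 / θ := by positivity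
      linarith
    have h6 := mul_le_mul_of_nonneg_left h5 (by positivity : (0 : ℝ) ≤ β / 2)
    have h7 := hanti h1
    linarith
  have hsum := Finset.sum_le_sum fun i (_ : i ∈ Finset.univ) => hterm i
  simp only [Finset.sum_add_distrib, Finset.sum_sub_distrib, ← Finset.mul_sum] at hsum
  rw [hforce] at hsum
  have hk2 : k ^ 2 ≤ D * ‖d‖ ^ 2 / (4 * ‖w‖) := by
    have : k ^ 2 = ‖d‖ ^ 2 * ‖d‖ ^ 2 / (4 * (‖w‖ * ‖w‖)) := by rw [hk]; ring
    rw [this]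
    gcongr
    nlinarith
  have hbound : R₀ * k * B + β / 2 * ((1 + 1 / θ) * (k ^ 2 * A)) ≤ C / ‖w‖ * ‖d‖ ^ 2 := by
    calc R₀ * k * B + β / 2 * ((1 + 1 / θ) * (k ^ 2 * A))
        ≤ R₀ * k * B + β / 2 * ((1 + 1 / θ) * (D * ‖d‖ ^ 2 / (4 * ‖w‖) * A)) := by gcongr
      _ = C / ‖w‖ * ‖d‖ ^ 2 := by rw [hk, hC]; ring
  have hb2 : C / ‖w‖ * ‖d‖ ^ 2 ≤ gap / 4 * ‖d‖ ^ 2 := by gcongr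
  have hb3 : β / 2 * ((1 + θ) * ∑ i, g i ^ 2) ≤ β / 2 * ((1 + θ) * (S ^ 2 * ‖d‖ ^ 2)) := by gcongr
  have hb4 : β / 2 * ((1 + θ) * (S ^ 2 * ‖d‖ ^ 2)) ≤
      (β * S ^ 2 / 2 + gap / 2) * ‖d‖ ^ 2 := by
    have : β / 2 * ((1 + θ) * (S ^ 2 * ‖d‖ ^ 2)) =
      (β * S ^ 2 / 2 + β * S ^ 2 * θ / 2) * ‖d‖ ^ 2 := by ring
    rw [this]
    gcongr
  have hb5 : ‖d‖ ^ 2 / η = (gap + β * S ^ 2 / 2) * ‖d‖ ^ 2 := by rw [hgap]; ring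
  linarith

/-- Gradient descent eventually reaches, and then never leaves, the region of large margins, where
the loss decreases at every step. -/
theorem exists_eventually_margin_ge [Nonempty ι] {S η R₀ K : ℝ} {β : NNReal} {ℓ : ℝ → ℝ}
    (hℓ0 : ∀ u, 0 ≤ ℓ u) (hℓ : Differentiable ℝ ℓ)
    (hanti : StrictAnti ℓ) (hlip : LipschitzWith β (deriv ℓ)) (hη : 0 < η)
    (hηβ : η * (β * S ^ 2) < 2) (he : ∀ i, 0 ≤ e i) (hr : ∀ u, 0 ≤ -deriv ℓ u)
    (hlow : ∀ M : ℝ, ∃ δ : ℝ, 0 < δ ∧ ∀ u : ℝ, u ≤ M → deriv ℓ u ≤ -δ)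
    (hR : ∀ u, 0 ≤ u → -deriv ℓ u ≤ R₀)
    (hK : ∀ u, 2 * (-deriv ℓ u * u) + η * S ^ 2 * (-deriv ℓ u) ^ 2 ≤ K)
    (hS : ∀ w, ∀ b : ι → ℝ, ‖∑ i, b i • marginGrad (z i) (e i) w‖ ^ 2 ≤ S ^ 2 * ∑ i, b i ^ 2)
    {W : E} (hW : ∀ i, 1 ≤ robustMargin (z i) (e i) W) {w : ℕ → E}
    (hw : ∀ t, w (t + 1) = w t + η • marginForce z e (fun u => -deriv ℓ u) (w t)) :
    ∃ κ : ℝ, 0 < κ ∧ ∀ U : ℝ, ∃ t₀, ∀ t, t₀ ≤ t → (∀ i, U ≤ robustMargin (z i) (e i) (w t)) ∧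
      ∑ i, ℓ (robustMargin (z i) (e i) (w (t + 1))) + κ * ‖w (t + 1) - w t‖ ^ 2 ≤
        ∑ i, ℓ (robustMargin (z i) (e i) (w t)) := by
  obtain ⟨M, κ, hM, hκ, hdesc⟩ := exists_descent hℓ hanti.antitone hlip hη hηβ he hr hR hS
  refine ⟨κ, hκ, fun U => ?_⟩
  obtain ⟨i₀⟩ := ‹Nonempty ι›
  -- The second term ensures that a margin at least `U'` forces `‖w t‖ ≥ M`, as the descent estimate
  -- requires.
  set U' := max U (M * (‖z i₀‖ + 1)) with hU'
  have hU'0 : 0 ≤ U' := le_trans (by positivity) (le_max_right _ _)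
  set L : ℝ := ⨅ u, ℓ u with hL
  have hbdd : BddBelow (Set.range ℓ) := ⟨0, by rintro _ ⟨u, rfl⟩; exact hℓ0 u⟩
  have hLle : ∀ u, L ≤ ℓ u := fun u => ciInf_le hbdd u
  have hLlt : L < ℓ U' := (hLle (U' + 1)).trans_lt (hanti (by linarith))
  have htend : Tendsto ℓ atTop (𝓝 L) := tendsto_atTop_ciInf hanti.antitone hbdd
  set n : ℝ := (Fintype.card ι : ℝ) with hn
  have hn0 : 0 < n := by
    rw [hn]; exact_mod_cast Fintype.card_pos_iff.2 ⟨i₀⟩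
  -- Loss is measured above its infimum `L`: total excess below `ℓ U' - L` forces every margin to be
  -- at least `U'`. Beyond `M₁` each term uses less than a `1 / n` share of that excess.
  obtain ⟨M₁, hM₁⟩ := (htend.eventually
    (gt_mem_nhds (show L < L + (ℓ U' - L) / n by
      have : 0 < (ℓ U' - L) / n := div_pos (by linarith) hn0
      linarith))).exists
  obtain ⟨δ, hδ, hδM⟩ := hlow M₁
  obtain ⟨t₀, ht₀⟩ := exists_sum_rate_lt (r := fun u => -deriv ℓ u) hη he hr hK hS hW hw hδ
  have hmarg : ∀ t, ∑ i, (ℓ (robustMargin (z i) (e i) (w t)) - L) < ℓ U' - L →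
      ∀ i, U' ≤ robustMargin (z i) (e i) (w t) := by
    intro t ht i
    by_contra! hi
    have h1 := hanti hi
    have h2 := Finset.single_le_sum
      (f := fun i => ℓ (robustMargin (z i) (e i) (w t)) - L)
      (fun j _ => sub_nonneg.2 (hLle _)) (Finset.mem_univ i)
    linarith
  have hstep : ∀ t, (∀ i, U' ≤ robustMargin (z i) (e i) (w t)) →
      ∑ i, ℓ (robustMargin (z i) (e i) (w (t + 1))) + κ * ‖w (t + 1) - w t‖ ^ 2 ≤
        ∑ i, ℓ (robustMargin (z i) (e i) (w t)) := by
    intro t ht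
    have hd : w (t + 1) = w t + (w (t + 1) - w t) := by abel
    have hnorm : M ≤ ‖w t‖ := by
      have h1 : M * (‖z i₀‖ + 1) ≤ ‖z i₀‖ * ‖w t‖ := by
        refine ((le_max_right _ _).trans (ht i₀)).trans ?_
        rw [robustMargin]
        have := mul_nonneg (he i₀) (norm_nonneg (w t))
        linarith [real_inner_le_norm (z i₀) (w t)]
      have h2 : M * (‖z i₀‖ + 1) ≤ ‖w t‖ * (‖z i₀‖ + 1) := by
        nlinarith [norm_nonneg (w t)]
      exact le_of_mul_le_mul_right h2 (by positivity)
    have := hdesc (w t) (w (t + 1) - w t) (by rw [hw t]; abel)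
      (fun i => hU'0.trans (ht i)) hnorm
    rwa [← hd] at this
  have hinv : ∀ t, t₀ ≤ t → ∑ i, (ℓ (robustMargin (z i) (e i) (w t)) - L) < ℓ U' - L := by
    intro t ht
    induction t, ht using Nat.le_induction with
    | base =>
      have hall : ∀ i, ℓ (robustMargin (z i) (e i) (w t₀)) - L ≤ ℓ M₁ - L := by
        intro i
        have hgt : M₁ < robustMargin (z i) (e i) (w t₀) := by
          by_contra! hle
          have h1 := hδM _ hle
          have h2 := Finset.single_le_sum
            (f := fun i => -deriv ℓ (robustMargin (z i) (e i) (w t₀)))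
            (fun j _ => hr _) (Finset.mem_univ i)
          linarith
        linarith [hanti hgt]
      have h1 := Finset.sum_le_sum fun i (_ : i ∈ Finset.univ) => hall i
      refine h1.trans_lt ?_
      rw [Finset.sum_const, nsmul_eq_mul, Finset.card_univ, ← hn, ← lt_div_iff₀' hn0]
      linarith
    | succ t ht ih =>
      have h1 := hstep t (hmarg t ih)
      rw [Finset.sum_sub_distrib] at ih ⊢
      have : 0 ≤ κ * ‖w (t + 1) - w t‖ ^ 2 := by positivity
      linarith
  refine ⟨t₀, fun t ht => ?_⟩
  have h1 := hmarg t (hinv t ht)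
  exact ⟨fun i => (le_max_left _ _).trans (h1 i), hstep t h1⟩

end Dynamics

/-! ### Boundedness of the deviation from the max-margin ray -/

theorem exp_neg_mul_le_inv_sq {b s : ℝ} (hb : 0 < b) (hs : 0 < s) :
    exp (-(b * s)) ≤ 2 / b ^ 2 * (1 / s ^ 2) := by
  have h1 : (b * s) ^ 2 / 2 ≤ exp (b * s) := by
    have := quadratic_le_exp_of_nonneg (mul_pos hb hs).le
    have : 0 < b * s := mul_pos hb hs
    linarith
  rw [exp_neg, inv_le_comm₀ (exp_pos _) (by positivity)]
  refine le_trans (le_of_eq ?_) h1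
  field_simp

section Tail

variable {r : ℝ → ℝ} {a k τ μ : ℝ}

/-- The reference margin `v` misses its ideal value `s + g` by `O(1 / s)`, so replacing the weight
`exp (-a v)` by the ideal one costs `O(exp (-a s) / s) * |u - v|`. The contraction absorbs this cost
and also the term with `B`, a reserve later spent on the coupling between constraints. -/
theorem active_term_le (ha : 0 < a) (hk : 0 < k) (hμ : 0 < μ)
    (htail : ∀ u, τ < u → r u ≤ k * (1 + exp (-μ * u)) * exp (-a * u) ∧
      k * (1 - exp (-μ * u)) * exp (-a * u) ≤ r u)
    {U : ℝ} (hU : τ < U) (hU4 : exp (-μ * U) ≤ 1 / 4) (g : ℝ) {K₁ B : ℝ} (hK₁ : 0 ≤ K₁)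
    (hB : 0 ≤ B) :
    ∃ s₀ C : ℝ, 0 ≤ C ∧ ∀ s u v, 1 ≤ s → s₀ ≤ s → U ≤ u → s + g - K₁ / s ≤ v → v ≤ s + g →
      (r u - k * exp (-a * (s + g))) * (u - v) + exp (-a * s) * (B / s) * |u - v| ≤
        C * (exp (-a * s) / s ^ 2) := by
  obtain ⟨κ, C, hκ, hC, hcontr⟩ := tail_contraction ha hk hμ htail hU hU4
  set κ' := κ * exp (-a * g) with hκ'
  have hκ'0 : 0 < κ' := by positivity
  set B' := k * exp (-a * g) * (a * K₁ * exp (a * K₁)) with hB'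
  have hB'0 : 0 ≤ B' := by positivity
  refine ⟨(B + B') / κ', (B + B') ^ 2 / κ' + C * exp ((a + μ) * (K₁ - g)) * (2 / μ ^ 2),
    by positivity, fun s u v hs1 hs0 hu hv1 hv2 => ?_⟩
  have hs : 0 < s := by linarith
  have hKs : K₁ / s ≤ K₁ := div_le_self hK₁ hs1
  have hKs0 : 0 ≤ K₁ / s := by positivity
  set x := u - v with hx
  have h0 := hcontr u v hu
  have h1 : exp (-a * s) * exp (-a * g) ≤ exp (-a * v) := by
    rw [← exp_add]; apply exp_le_exp.2; nlinarith
  have h2 : exp (-a * v) ≤ exp (-a * s) * exp (-a * g) * exp (a * (K₁ / s)) := by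
    rw [← exp_add, ← exp_add]; apply exp_le_exp.2; nlinarith
  have h3 : exp (a * (K₁ / s)) - 1 ≤ a * (K₁ / s) * exp (a * K₁) := by
    have h4 : exp (a * (K₁ / s)) ≤ exp (a * K₁) := exp_le_exp.2 (by gcongr)
    have h5 : 1 - a * (K₁ / s) ≤ exp (-(a * (K₁ / s))) := one_sub_le_exp_neg _
    have h6 : exp (a * (K₁ / s)) * exp (-(a * (K₁ / s))) = 1 := by rw [← exp_add]; simp
    have h7 : 0 ≤ a * (K₁ / s) := by positivity
    have h8 := exp_pos (a * (K₁ / s))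
    nlinarith
  have hA : exp (-a * (s + g)) = exp (-a * s) * exp (-a * g) := by
    rw [← exp_add]; ring_nf
  have hEs := exp_pos (-a * s)
  have hdiff : (k * exp (-a * v) - k * exp (-a * (s + g))) * x ≤
      exp (-a * s) * (B' / s) * |x| := by
    have h9 : 0 ≤ k * exp (-a * v) - k * exp (-a * (s + g)) := by
      rw [hA, ← mul_sub]; exact mul_nonneg hk.le (by linarith)
    have h10 : k * exp (-a * v) - k * exp (-a * (s + g)) ≤ exp (-a * s) * (B' / s) := by
      calc k * exp (-a * v) - k * exp (-a * (s + g))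
          ≤ k * (exp (-a * s) * exp (-a * g) * exp (a * (K₁ / s))) -
            k * (exp (-a * s) * exp (-a * g)) := by rw [hA]; gcongr
        _ = k * (exp (-a * s) * exp (-a * g)) * (exp (a * (K₁ / s)) - 1) := by ring
        _ ≤ k * (exp (-a * s) * exp (-a * g)) * (a * (K₁ / s) * exp (a * K₁)) := by gcongr
        _ = _ := by rw [hB']; ring
    calc _ ≤ (k * exp (-a * v) - k * exp (-a * (s + g))) * |x| := by
          gcongr; exact le_abs_self x
      _ ≤ _ := by gcongr
  have hmin0 : 0 ≤ min |x| (x ^ 2) := le_min (abs_nonneg _) (sq_nonneg _)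
  have hcon : -κ * exp (-a * v) * min |x| (x ^ 2) ≤
      exp (-a * s) * (-κ' * min |x| (x ^ 2)) := by
    have : κ * (exp (-a * s) * exp (-a * g)) * min |x| (x ^ 2) ≤
        κ * exp (-a * v) * min |x| (x ^ 2) := by gcongr
    rw [hκ']
    linarith
  have herr : C * exp (-(a + μ) * v) ≤
      C * exp ((a + μ) * (K₁ - g)) * (2 / μ ^ 2) * (exp (-a * s) / s ^ 2) := by
    have h11 : exp (-(a + μ) * v) ≤
        exp ((a + μ) * (K₁ - g)) * (exp (-a * s) * exp (-(μ * s))) := by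
      rw [← exp_add, ← exp_add]; apply exp_le_exp.2; nlinarith
    calc C * exp (-(a + μ) * v)
        ≤ C * (exp ((a + μ) * (K₁ - g)) * (exp (-a * s) * exp (-(μ * s)))) := by gcongr
      _ ≤ C * (exp ((a + μ) * (K₁ - g)) * (exp (-a * s) * (2 / μ ^ 2 * (1 / s ^ 2)))) := by
          gcongr; exact exp_neg_mul_le_inv_sq hμ hs
      _ = _ := by ring
  have hfin := neg_mul_min_add_le hκ'0 (by positivity : 0 ≤ B + B') hs
    (by rwa [div_le_iff₀' hκ'0] at hs0) x
  have hfin' := mul_le_mul_of_nonneg_left hfin hEs.le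
  have e1 : exp (-a * s) * (-κ' * min |x| (x ^ 2) + (B + B') / s * |x|) =
    exp (-a * s) * (-κ' * min |x| (x ^ 2)) + exp (-a * s) * (B / s) * |x| +
      exp (-a * s) * (B' / s) * |x| := by ring
  have e2 : exp (-a * s) * ((B + B') ^ 2 / κ' * (1 / s ^ 2)) =
    (B + B') ^ 2 / κ' * (exp (-a * s) / s ^ 2) := by ring
  rw [e1, e2] at hfin'
  have e3 : (r u - k * exp (-a * (s + g))) * x =
    (r u - k * exp (-a * v)) * x + (k * exp (-a * v) - k * exp (-a * (s + g))) * x := by ring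
  rw [e3, add_mul]
  linarith

/-- The surplus `m - 1` gives an extra factor `exp (-a (m - 1) s)`, which beats `1 / s ^ 2`. -/
theorem inactive_term_le (ha : 0 < a) (hk : 0 < k) (hτ : 0 < τ) (hμ : 0 < μ)
    (hr0 : ∀ u, 0 ≤ r u)
    (hub : ∀ u, τ < u → r u ≤ k * (1 + exp (-μ * u)) * exp (-a * u)) (g : ℝ) {K₁ m : ℝ}
    (hK₁ : 0 ≤ K₁) (hm : 1 < m) :
    ∃ C : ℝ, 0 ≤ C ∧ ∀ s u v, 1 ≤ s → τ < u → s * m + g - K₁ / s ≤ v →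
      r u * (u - v) ≤ C * (exp (-a * s) / s ^ 2) := by
  have hb : 0 < a * (m - 1) := mul_pos ha (by linarith)
  refine ⟨2 * k / a * exp (a * (K₁ - g)) * (2 / (a * (m - 1)) ^ 2), by positivity,
    fun s u v hs1 hu hv => ?_⟩
  have hs : 0 < s := by linarith
  have hKs : K₁ / s ≤ K₁ := div_le_self hK₁ hs1
  have h1 : exp (-a * v) ≤ exp (a * (K₁ - g)) * (exp (-a * s) * exp (-(a * (m - 1) * s))) := by
    rw [← exp_add, ← exp_add]; apply exp_le_exp.2; nlinarith
  calc r u * (u - v) ≤ 2 * k / a * exp (-a * v) := tail_mul_sub_le ha hk hτ hμ hr0 hub hu v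
    _ ≤ 2 * k / a * (exp (a * (K₁ - g)) * (exp (-a * s) * exp (-(a * (m - 1) * s)))) := by gcongr
    _ ≤ 2 * k / a * (exp (a * (K₁ - g)) * (exp (-a * s) *
        (2 / (a * (m - 1)) ^ 2 * (1 / s ^ 2)))) := by
        gcongr; exact exp_neg_mul_le_inv_sq hb hs
    _ = _ := by ring

variable {E : Type*} [NormedAddCommGroup E] [InnerProductSpace ℝ E] {ι : Type*} [Fintype ι]
  {z : ι → E} {e α : ι → ℝ} {W : E}

/-- The coordinate of `w` along `W`. -/
noncomputable def rayCoord (W w : E) : ℝ := inner ℝ W w / ‖W‖ ^ 2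

/-- The deviation of `w` from the ray through `W` translated by `v`. -/
noncomputable def rayDeviation (W v w : E) : E := w - (rayCoord W w • W + v)

theorem inner_rayDeviation (hW : W ≠ 0) {v : E} (hv : inner ℝ W v = 0) (w : E) :
    inner ℝ W (rayDeviation W v w) = 0 := by
  have hN : ‖W‖ ≠ 0 := norm_ne_zero_iff.2 hW
  rw [rayDeviation, inner_sub_right, inner_add_right, real_inner_smul_right, hv,
    real_inner_self_eq_norm_sq, rayCoord]
  field_simp
  ring

/-- Pythagoras: only the part of `d` orthogonal to `W` changes the deviation. -/
theorem norm_sq_rayDeviation_add_le (hW : W ≠ 0) {v : E} (hv : inner ℝ W v = 0) (w d : E) :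
    ‖rayDeviation W v (w + d)‖ ^ 2 ≤
      ‖rayDeviation W v w‖ ^ 2 + 2 * inner ℝ d (rayDeviation W v w) + ‖d‖ ^ 2 := by
  have h1 : rayDeviation W v w + d =
      rayDeviation W v (w + d) + (rayCoord W (w + d) - rayCoord W w) • W := by
    simp only [rayDeviation, sub_smul]
    abel
  have h2 := norm_add_sq_real (rayDeviation W v w) d
  have h3 := norm_add_sq_real (rayDeviation W v (w + d)) ((rayCoord W (w + d) - rayCoord W w) • W)
  rw [h1, real_inner_comm] at h2
  rw [real_inner_smul_right, real_inner_comm, inner_rayDeviation hW hv] at h3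
  nlinarith [sq_nonneg ‖(rayCoord W (w + d) - rayCoord W w) • W‖]

/-- The force does not increase the deviation from the translated ray by more than a summable
amount. -/
theorem inner_marginForce_rayDeviation_le (ha : 0 < a) (hk : 0 < k) (hτ : 0 < τ) (hμ : 0 < μ)
    (hr0 : ∀ u, 0 ≤ r u)
    (htail : ∀ u, τ < u → r u ≤ k * (1 + exp (-μ * u)) * exp (-a * u) ∧
      k * (1 - exp (-μ * u)) * exp (-a * u) ≤ r u)
    {U : ℝ} (hU : τ < U) (hU4 : exp (-μ * U) ≤ 1 / 4)
    (he : ∀ i, 0 ≤ e i) (hW : W ≠ 0) (h : IsRobustKKT z e W α) {v : E} {c : ι → ℝ} {Θ : ℝ}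
    (hΘ : 0 < Θ) (hWv : inner ℝ W v = 0) (hvc : v = ∑ i, c i • marginGrad (z i) (e i) W)
    (hc : ∀ i, robustMargin (z i) (e i) W ≠ 1 → c i = 0)
    (hexp : ∀ i, robustMargin (z i) (e i) W = 1 →
        exp (-a * inner ℝ (marginGrad (z i) (e i) W) v) = Θ * α i) :
    ∃ s₀ C : ℝ, 0 ≤ C ∧ ∀ w : E, (∀ i, U ≤ robustMargin (z i) (e i) w) → 1 ≤ rayCoord W w →
      s₀ ≤ rayCoord W w →
      inner ℝ (marginForce z e r w) (rayDeviation W v w) ≤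
        C * (exp (-a * rayCoord W w) / rayCoord W w ^ 2) * (1 + ‖rayDeviation W v w‖ ^ 2) := by
  have hN : 0 < ‖W‖ := norm_pos_iff.2 hW
  set m : ι → ℝ := fun i => robustMargin (z i) (e i) W with hm
  set g : ι → ℝ := fun i => inner ℝ (marginGrad (z i) (e i) W) v with hg
  set K₁ : ι → ℝ := fun i => e i * (‖v‖ ^ 2 / (2 * ‖W‖)) with hK₁
  have hK₁0 : ∀ i, 0 ≤ K₁ i := fun i => mul_nonneg (he i) (by positivity)
  have hα0 : ∀ i, m i ≠ 1 → α i = 0 := fun i hi =>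
    (mul_eq_zero.1 (h.slack i)).resolve_right (sub_ne_zero.2 hi)
  -- The change `Δ` of the norm couples all constraints through a term at most `C₃ * exp (-a s) / s
  -- * |⟪v, ρ⟫|`. It sets the size of the reserve requested from each active constraint in `hterm`.
  set C₃ : ℝ := ∑ i, k * Θ * α i * e i / ‖W‖ with hC₃
  have hC₃0 : 0 ≤ C₃ := Finset.sum_nonneg fun i _ =>
    div_nonneg (mul_nonneg (mul_nonneg (by positivity) (h.nonneg i)) (he i)) hN.le
  have hterm : ∀ i, ∃ s₀ C : ℝ, 0 ≤ C ∧ ∀ s u x, 1 ≤ s → s₀ ≤ s → U ≤ u →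
      s * m i + g i - K₁ i / s ≤ x → x ≤ s * m i + g i →
      (r u - k * (exp (-a * s) * (Θ * α i))) * (u - x) +
        exp (-a * s) * (C₃ * |c i| / s) * |u - x| ≤ C * (exp (-a * s) / s ^ 2) := by
    intro i
    by_cases hi : m i = 1
    · obtain ⟨s₀, C, hC, hb⟩ := active_term_le ha hk hμ htail hU hU4 (g i) (hK₁0 i)
        (mul_nonneg hC₃0 (abs_nonneg (c i)))
      refine ⟨s₀, C, hC, fun s u x hs1 hs0 hu hx1 hx2 => ?_⟩
      rw [hi, mul_one] at hx1 hx2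
      have := hb s u x hs1 hs0 hu hx1 hx2
      have hA : exp (-a * (s + g i)) = exp (-a * s) * (Θ * α i) := by
        have hgi : exp (-a * g i) = Θ * α i := hexp i hi
        rw [← hgi, ← exp_add]; ring_nf
      rwa [hA] at this
    · obtain ⟨C, hC, hb⟩ := inactive_term_le ha hk hτ hμ hr0 (fun u hu => (htail u hu).1) (g i)
        (hK₁0 i) (lt_of_le_of_ne (h.feasible i) (Ne.symm hi))
      refine ⟨1, C, hC, fun s u x hs1 _ hu hx1 _ => ?_⟩
      have := hb s u x hs1 (hU.trans_le hu) hx1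
      rw [hα0 i hi, hc i hi]
      simpa using this
  choose s₀ C hC hb using hterm
  set C₂ : ℝ := (∑ j, |c j| * e j) * ((‖v‖ + 1) / ‖W‖) with hC₂
  have hC₂0 : 0 ≤ C₂ := mul_nonneg (Finset.sum_nonneg fun i _ =>
    mul_nonneg (abs_nonneg _) (he i)) (by positivity)
  refine ⟨∑ i, |s₀ i|, (∑ i, C i) + C₃ * C₂,
    add_nonneg (Finset.sum_nonneg fun i _ => hC i) (by positivity), fun w hu hs1 hs0 => ?_⟩
  set s := rayCoord W w with hs_def
  have hs : 0 < s := by linarith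
  set ρ := rayDeviation W v w with hρ
  set q := s • W + v with hq
  have hwq : w = q + ρ := by rw [hρ, rayDeviation, ← hs_def, hq]; abel
  have hWρ : inner ℝ W ρ = 0 := inner_rayDeviation hW hWv w
  have hsW : s • W ≠ 0 := smul_ne_zero hs.ne' hW
  have hnsW : ‖s • W‖ = s * ‖W‖ := by rw [norm_smul, Real.norm_of_nonneg hs.le]
  have hq_low : s * ‖W‖ ≤ ‖q‖ := by
    have h1 := norm_add_ge_linear (w := s • W) v
    rw [real_inner_smul_left, real_inner_smul_left, hWv, hnsW] at h1
    simpa using h1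
  have hq_up : ‖q‖ ≤ s * ‖W‖ + ‖v‖ ^ 2 / (2 * ‖W‖) / s := by
    have h1 := norm_add_le_quadratic hsW v
    rw [real_inner_smul_left, real_inner_smul_left, hWv, hnsW] at h1
    refine h1.trans_eq ?_
    field_simp
    ring
  have hq0 : 0 < ‖q‖ := lt_of_lt_of_le (by positivity) hq_low
  have hqne : q ≠ 0 := norm_pos_iff.1 hq0
  set x : ι → ℝ := fun i => robustMargin (z i) (e i) q with hx
  set δ : ι → ℝ := fun i => robustMargin (z i) (e i) w - x i with hδ
  have hzq : ∀ i, x i = s * m i + g i - e i * (‖q‖ - s * ‖W‖) := by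
    intro i
    simp only [hx, hm, hg, robustMargin, inner_marginGrad, real_inner_smul_left, hWv]
    rw [hq, inner_add_right, real_inner_smul_right]
    ring
  have hx_low : ∀ i, s * m i + g i - K₁ i / s ≤ x i := by
    intro i
    rw [hzq i, hK₁]
    have := mul_le_mul_of_nonneg_left (sub_le_iff_le_add'.2 hq_up) (he i)
    have h2 : e i * (‖v‖ ^ 2 / (2 * ‖W‖)) / s = e i * (‖v‖ ^ 2 / (2 * ‖W‖) / s) := by ring
    simp only [h2]
    linarith
  have hx_up : ∀ i, x i ≤ s * m i + g i := by
    intro i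
    rw [hzq i]
    have := mul_nonneg (he i) (sub_nonneg.2 hq_low)
    linarith
  set Δ := ‖w‖ - ‖q‖ with hΔ
  have hGρ : ∀ i, inner ℝ (marginGrad (z i) (e i) W) ρ = δ i + e i * Δ := by
    intro i
    rw [inner_marginGrad, real_inner_smul_left, hWρ]
    simp only [hδ, hx, robustMargin, hΔ]
    have : inner ℝ (z i) w = inner ℝ (z i) q + inner ℝ (z i) ρ := by
      rw [← inner_add_right, ← hwq]
    rw [this]
    ring
  have hqρ : inner ℝ (‖q‖⁻¹ • q) ρ = inner ℝ v ρ / ‖q‖ := by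
    rw [real_inner_smul_left, hq, inner_add_left, real_inner_smul_left, hWρ]
    ring
  have hΔ_low : inner ℝ v ρ / ‖q‖ ≤ Δ := by
    have h1 := norm_add_ge_linear (w := q) ρ
    rw [hqρ, ← hwq] at h1
    linarith
  have hΔ_up : Δ ≤ inner ℝ v ρ / ‖q‖ + ‖ρ‖ ^ 2 / (2 * ‖q‖) := by
    have h1 := norm_add_le_quadratic hqne ρ
    rw [hqρ, ← hwq] at h1
    linarith
  set P := 1 + ‖ρ‖ ^ 2 with hP
  have hP1 : 1 ≤ P := by rw [hP]; linarith [sq_nonneg ‖ρ‖]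
  set Y := |inner ℝ v ρ| with hY
  have hYP : Y ≤ ‖v‖ * P := by
    refine (abs_real_inner_le_norm v ρ).trans ?_
    gcongr
    nlinarith [sq_nonneg (‖ρ‖ - 1), norm_nonneg ρ]
  have hΔ_neg : -Δ ≤ Y / (s * ‖W‖) := by
    have h1 : -(inner ℝ v ρ / ‖q‖) ≤ Y / ‖q‖ := by
      rw [← neg_div]; gcongr; exact neg_le_abs _
    have h2 : Y / ‖q‖ ≤ Y / (s * ‖W‖) := by gcongr
    linarith
  have hΔ_abs : |Δ| ≤ (‖v‖ + 1) / ‖W‖ * (P / s) := by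
    have h3 : (‖v‖ + 1) / ‖W‖ * (P / s) = ‖v‖ * P / (s * ‖W‖) + P / (s * ‖W‖) := by
      field_simp
    have h4 : Y / (s * ‖W‖) ≤ ‖v‖ * P / (s * ‖W‖) := by gcongr
    have h5 : 0 ≤ P / (s * ‖W‖) := by positivity
    rw [h3, abs_le]
    constructor
    · linarith
    · have h6 : inner ℝ v ρ / ‖q‖ ≤ Y / (s * ‖W‖) :=
        (div_le_div_of_nonneg_right (le_abs_self _) hq0.le).trans (by gcongr)
      have h7 : ‖ρ‖ ^ 2 / (2 * ‖q‖) ≤ P / (s * ‖W‖) :=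
        div_le_div₀ (by positivity) (by rw [hP]; linarith) (by positivity) (by linarith)
      linarith
  -- This is why `v` must lie in the span of the active gradients: `⟪v, ρ⟫` is then controlled by
  -- the active margin deviations, which the reserves pay for.
  have hYsum : Y ≤ ∑ j, |c j| * |δ j| + C₂ * (P / s) := by
    have h1 : inner ℝ v ρ = ∑ j, c j * (δ j + e j * Δ) := by
      conv_lhs => rw [hvc, sum_inner]
      refine Finset.sum_congr rfl fun j _ => ?_
      rw [real_inner_smul_left, hGρ]
    have h2 : ∀ j, |c j * (δ j + e j * Δ)| ≤
        |c j| * |δ j| + |c j| * e j * ((‖v‖ + 1) / ‖W‖ * (P / s)) := by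
      intro j
      rw [abs_mul, mul_assoc, ← mul_add]
      gcongr
      refine (abs_add_le _ _).trans ?_
      rw [abs_mul, abs_of_nonneg (he j)]
      have := mul_le_mul_of_nonneg_left hΔ_abs (he j)
      linarith
    rw [hY, h1]
    refine (Finset.abs_sum_le_sum_abs _ _).trans ((Finset.sum_le_sum fun j _ => h2 j).trans ?_)
    rw [Finset.sum_add_distrib, ← Finset.sum_mul, hC₂]
    linarith
  have hEs := exp_pos (-a * s)
  -- The ideal weights are proportional to `α`, so their force is parallel to `W` and orthogonal to
  -- `ρ`.
  have hzero : ∑ i, k * (exp (-a * s) * (Θ * α i)) * (δ i + e i * Δ) = 0 := by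
    have h1 : inner ℝ (∑ i, α i • marginGrad (z i) (e i) W) ρ = 0 := by
      rw [← h.stationary, hWρ]
    rw [sum_inner] at h1
    have h2 : ∑ i, k * (exp (-a * s) * (Θ * α i)) * (δ i + e i * Δ) =
        k * exp (-a * s) * Θ * ∑ i, inner ℝ (α i • marginGrad (z i) (e i) W) ρ := by
      rw [Finset.mul_sum]
      refine Finset.sum_congr rfl fun i _ => ?_
      rw [real_inner_smul_left, hGρ]
      ring
    rw [h2, h1, mul_zero]
  have hmain : inner ℝ (marginForce z e r w) ρ ≤
      ∑ i, r (robustMargin (z i) (e i) w) * δ i := by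
    rw [inner_marginForce]
    refine Finset.sum_le_sum fun i _ => mul_le_mul_of_nonneg_left ?_ (hr0 _)
    have h1 := inner_marginGrad_sub_le (z i) (he i) w q
    rwa [show w - q = ρ by rw [hwq]; abel] at h1
  have hsplit : ∀ i, r (robustMargin (z i) (e i) w) * δ i ≤
      C i * (exp (-a * s) / s ^ 2) - exp (-a * s) * (C₃ / s) * (|c i| * |δ i|) +
        k * (exp (-a * s) * (Θ * α i)) * (δ i + e i * Δ) +
        k * Θ * α i * e i / ‖W‖ * (exp (-a * s) / s * Y) := by
    intro i
    have hs0i : s₀ i ≤ s := (le_abs_self _).trans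
      ((Finset.single_le_sum (f := fun i => |s₀ i|) (fun j _ => abs_nonneg _)
        (Finset.mem_univ i)).trans hs0)
    have h1 := hb i s _ _ hs1 hs0i (hu i) (hx_low i) (hx_up i)
    have h2 : k * (exp (-a * s) * (Θ * α i)) * (e i * -Δ) ≤
        k * (exp (-a * s) * (Θ * α i)) * (e i * (Y / (s * ‖W‖))) := by
      have := h.nonneg i
      have := he i
      gcongr
    have h3 : k * (exp (-a * s) * (Θ * α i)) * (e i * (Y / (s * ‖W‖))) =
        k * Θ * α i * e i / ‖W‖ * (exp (-a * s) / s * Y) := by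
      field_simp
    have h4 : exp (-a * s) * (C₃ * |c i| / s) * |δ i| =
        exp (-a * s) * (C₃ / s) * (|c i| * |δ i|) := by ring
    rw [← h3, ← h4]
    linarith
  have hsum := Finset.sum_le_sum fun i (_ : i ∈ Finset.univ) => hsplit i
  rw [Finset.sum_add_distrib, Finset.sum_add_distrib, Finset.sum_sub_distrib, hzero,
    ← Finset.sum_mul, ← Finset.sum_mul, ← Finset.mul_sum, ← hC₃] at hsum
  have hlast : C₃ * (exp (-a * s) / s * Y) ≤
      exp (-a * s) * (C₃ / s) * ∑ j, |c j| * |δ j| + C₃ * C₂ * (exp (-a * s) / s ^ 2) * P := by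
    calc C₃ * (exp (-a * s) / s * Y)
        ≤ C₃ * (exp (-a * s) / s * (∑ j, |c j| * |δ j| + C₂ * (P / s))) := by gcongr
      _ = _ := by ring
  have hCP : (∑ i, C i) * (exp (-a * s) / s ^ 2) ≤ (∑ i, C i) * (exp (-a * s) / s ^ 2) * P :=
    le_mul_of_one_le_right (mul_nonneg (Finset.sum_nonneg fun i _ => hC i) (by positivity)) hP1
  linarith

/-- The `α`-mean of the margins is at most the ray coordinate, so some margin is, and its slope
alone suffices. -/
theorem exp_rayCoord_le_sum_rate (hk : 0 < k) (ha : 0 < a) (hμ : 0 < μ) (hr0 : ∀ u, 0 ≤ r u)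
    (hlb : ∀ u, τ < u → k * (1 - exp (-μ * u)) * exp (-a * u) ≤ r u)
    {U : ℝ} (hU : τ < U) (hU4 : exp (-μ * U) ≤ 1 / 4)
    (he : ∀ i, 0 ≤ e i) (hW : W ≠ 0) (h : IsRobustKKT z e W α) {w : E}
    (hu : ∀ i, U ≤ robustMargin (z i) (e i) w) :
    k / 2 * exp (-a * rayCoord W w) ≤ ∑ i, r (robustMargin (z i) (e i) w) := by
  have hN : 0 < ‖W‖ := norm_pos_iff.2 hW
  obtain ⟨i, hi⟩ : ∃ i, robustMargin (z i) (e i) w ≤ rayCoord W w := by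
    by_contra! hcon
    have h1 := h.sum_mul_margin_le he w
    have h2 : inner ℝ W w = rayCoord W w * ∑ i, α i := by
      rw [h.sum_eq, rayCoord, div_mul_cancel₀ _ (by positivity)]
    have h3 : ∃ i, 0 < α i := by
      by_contra! hle
      have := Finset.sum_nonpos fun i (_ : i ∈ Finset.univ) => hle i
      rw [h.sum_eq] at this
      nlinarith
    obtain ⟨j, hj⟩ := h3
    have h4 : rayCoord W w * ∑ i, α i < ∑ i, α i * robustMargin (z i) (e i) w := by
      rw [Finset.mul_sum]
      refine Finset.sum_lt_sum (fun i _ => ?_) ⟨j, Finset.mem_univ _, ?_⟩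
      · rw [mul_comm]; exact mul_le_mul_of_nonneg_left (hcon i).le (h.nonneg i)
      · rw [mul_comm]; exact mul_lt_mul_of_pos_left (hcon j) hj
    linarith
  refine le_trans ?_ (Finset.single_le_sum
    (f := fun i => r (robustMargin (z i) (e i) w)) (fun j _ => hr0 _) (Finset.mem_univ i))
  refine le_trans ?_ (hlb _ (hU.trans_le (hu i)))
  have h1 : exp (-μ * robustMargin (z i) (e i) w) ≤ 1 / 4 :=
    (exp_le_exp.2 (by nlinarith [hu i])).trans hU4
  have h2 : exp (-a * rayCoord W w) ≤ exp (-a * robustMargin (z i) (e i) w) :=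
    exp_le_exp.2 (by nlinarith)
  have h3 : k / 2 ≤ k * (1 - exp (-μ * robustMargin (z i) (e i) w)) := by nlinarith
  have : 0 ≤ k * (1 - exp (-μ * robustMargin (z i) (e i) w)) := by nlinarith
  gcongr

end Tail

/-- A discrete Grönwall argument: if `s` grows at least like a logarithm, a quantity driven by
errors of size `exp (-a s) / s ^ 2` and by the decrements of `L` stays bounded. -/
theorem bounded_of_exp_driven {s D L x : ℕ → ℝ} {a k₁ B C κ : ℝ} (hk₁ : 0 < k₁)
    (hB : 0 ≤ B) (hC : 0 ≤ C) (hκ : 0 < κ) (hs1 : ∀ t, 1 ≤ s t)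
    (hgrow : ∀ t, s t + k₁ * exp (-a * s t) ≤ s (t + 1)) (hinc : ∀ t, s (t + 1) ≤ s t + B)
    (hD0 : ∀ t, 0 ≤ D t) (hL0 : ∀ t, 0 ≤ L t) (hx : ∀ t, 0 ≤ x t)
    (hD : ∀ t, D (t + 1) ≤ D t + C * (exp (-a * s t) / s t ^ 2) * (1 + D t) + x t)
    (hL : ∀ t, L (t + 1) + κ * x t ≤ L t) : ∃ M, ∀ t, D t ≤ M := by
  -- A potential paying for future errors. Since `exp (-a s)` is at most the increment of `s` over
  -- `k₁`, the first error telescopes as `1 / s`; the factor `1 + B` compares `s (t + 1)` with `s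
  -- t`. Then `(1 + D) * exp P` is nonincreasing.
  set P : ℕ → ℝ := fun t => C * (1 + B) / k₁ * (1 / s t) + L t / κ with hP
  have hP0 : ∀ t, 0 ≤ P t := fun t => by
    have := hs1 t
    have := hL0 t
    positivity
  have hstep : ∀ t, C * (exp (-a * s t) / s t ^ 2) + x t ≤ P t - P (t + 1) := by
    intro t
    have h1 := hs1 t
    have h2 := hs1 (t + 1)
    have hx1 : x t ≤ L t / κ - L (t + 1) / κ := by
      rw [← sub_div, le_div_iff₀ hκ]; linarith [hL t]
    have hexp : exp (-a * s t) ≤ (s (t + 1) - s t) / k₁ := by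
      rw [le_div_iff₀ hk₁]; linarith [hgrow t]
    have hdiff0 : 0 ≤ (s (t + 1) - s t) / k₁ := (exp_pos _).le.trans hexp
    have hratio : 1 / s t ^ 2 ≤ (1 + B) * (1 / (s t * s (t + 1))) := by
      rw [mul_one_div, div_le_div_iff₀ (by positivity) (by positivity)]
      have : s (t + 1) ≤ (1 + B) * s t := by nlinarith [hinc t]
      nlinarith
    have h3 : exp (-a * s t) / s t ^ 2 ≤
        (s (t + 1) - s t) / k₁ * ((1 + B) * (1 / (s t * s (t + 1)))) := by
      rw [div_eq_mul_one_div]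
      gcongr
    have h4 : C * ((s (t + 1) - s t) / k₁ * ((1 + B) * (1 / (s t * s (t + 1))))) =
        C * (1 + B) / k₁ * (1 / s t) - C * (1 + B) / k₁ * (1 / s (t + 1)) := by
      field_simp
    have h5 := mul_le_mul_of_nonneg_left h3 hC
    simp only [hP]
    linarith
  have hanti : Antitone fun t => (1 + D t) * exp (P t) := by
    refine antitone_nat_of_succ_le fun t => ?_
    have h1 : 1 + D (t + 1) ≤ (1 + D t) * exp (P t - P (t + 1)) := by
      have h2 := add_one_le_exp (P t - P (t + 1))
      have h3 := hstep t
      have h4 : x t ≤ x t * (1 + D t) := le_mul_of_one_le_right (hx t) (by linarith [hD0 t])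
      have h5 : (1 + D t) * (1 + (C * (exp (-a * s t) / s t ^ 2) + x t)) ≤
          (1 + D t) * exp (P t - P (t + 1)) := by
        have := hD0 t
        gcongr
        linarith
      linarith [hD t]
    calc (1 + D (t + 1)) * exp (P (t + 1))
        ≤ (1 + D t) * exp (P t - P (t + 1)) * exp (P (t + 1)) := by gcongr
      _ = (1 + D t) * exp (P t) := by rw [mul_assoc, ← exp_add]; ring_nf
  refine ⟨(1 + D 0) * exp (P 0), fun t => ?_⟩
  have h1 := hanti (Nat.zero_le t)
  simp only at h1
  have h2 : 1 ≤ exp (P t) := one_le_exp (hP0 t)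
  nlinarith [hD0 t]

/-- By convexity of `exp`, `exp (a s)` gains at least `a * k₁` per step, as for the flow `s' = k₁
exp (-a s)`. -/
theorem mul_le_exp_of_exp_growth {s : ℕ → ℝ} {a k₁ : ℝ} (ha : 0 < a)
    (hgrow : ∀ t, s t + k₁ * exp (-a * s t) ≤ s (t + 1)) (t : ℕ) :
    a * k₁ * t ≤ exp (a * s t) := by
  induction t with
  | zero => simpa using (exp_pos _).le
  | succ t ih =>
    have h1 : exp (a * s t) * (1 + a * k₁ * exp (-a * s t)) ≤ exp (a * s (t + 1)) := by
      have h2 : exp (a * s t) * exp (a * k₁ * exp (-a * s t)) ≤ exp (a * s (t + 1)) := by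
        rw [← exp_add]
        apply exp_le_exp.2
        nlinarith [hgrow t]
      refine le_trans ?_ h2
      gcongr
      linarith [add_one_le_exp (a * k₁ * exp (-a * s t))]
    have h3 : exp (a * s t) * exp (-a * s t) = 1 := by rw [← exp_add]; simp
    have h4 : exp (a * s t) * (1 + a * k₁ * exp (-a * s t)) = exp (a * s t) + a * k₁ := by
      linear_combination a * k₁ * h3
    rw [h4] at h1
    push_cast
    linarith

/-! ### From bounded deviation to the logarithmic rate. -/

section Rate

variable {E : Type*} [NormedAddCommGroup E] [InnerProductSpace ℝ E] {ι : Type*} [Fintype ι]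
  {z : ι → E} {e α : ι → ℝ} {W : E}

theorem le_rayCoord (he : ∀ i, 0 ≤ e i) (hW : W ≠ 0) (h : IsRobustKKT z e W α) {w : E} {U : ℝ}
    (hu : ∀ i, U ≤ robustMargin (z i) (e i) w) : U ≤ rayCoord W w := by
  have hN : 0 < ‖W‖ := norm_pos_iff.2 hW
  rw [rayCoord, le_div_iff₀ (by positivity)]
  refine le_trans ?_ (h.sum_mul_margin_le he w)
  rw [← h.sum_eq, Finset.mul_sum]
  refine Finset.sum_le_sum fun i _ => ?_
  rw [mul_comm]
  exact mul_le_mul_of_nonneg_left (hu i) (h.nonneg i)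

theorem rayCoord_add (w d : E) : rayCoord W (w + d) = rayCoord W w + rayCoord W d := by
  rw [rayCoord, rayCoord, rayCoord, inner_add_right, add_div]

theorem exists_rate_of_bounded_deviation {w : ℕ → E} (hW : W ≠ 0) {v : E} {a k₁ M : ℝ} (ha : 0 < a)
    (hk₁ : 0 < k₁) (t₀ : ℕ) (hD : ∀ t, ‖rayDeviation W v (w (t₀ + t))‖ ^ 2 ≤ M)
    (hexp : ∀ t : ℕ, a * k₁ * t ≤ exp (a * rayCoord W (w (t₀ + t)))) :
    ∃ (C : ℝ) (T : ℕ), ∀ t, T ≤ t →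
      ‖‖w t‖⁻¹ • w t - ‖W‖⁻¹ • W‖ ≤ C / log t := by
  have hN : 0 < ‖W‖ := norm_pos_iff.2 hW
  have hb : 0 < a * k₁ := mul_pos ha hk₁
  -- Past `T₁`, `√T ≤ a * k₁ * T / 2`; the square root absorbs the constants and gives `s ≥ log T /
  -- (2 * a)`.
  obtain ⟨T₁, hT₁⟩ := exists_nat_ge (4 / (a * k₁) ^ 2)
  refine ⟨2 * (‖v‖ + √M) * (2 * a) / ‖W‖, max 2 (max (2 * t₀) T₁), fun t ht => ?_⟩
  simp only [max_le_iff] at ht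
  obtain ⟨ht2, ht0, ht1⟩ := ht
  obtain ⟨t', rfl⟩ : ∃ t', t = t₀ + t' := ⟨t - t₀, by omega⟩
  set T : ℝ := ((t₀ + t' : ℕ) : ℝ) with hT
  have hT2 : (2 : ℝ) ≤ T := by rw [hT]; exact_mod_cast ht2
  have hT4 : 4 / (a * k₁) ^ 2 ≤ T := hT₁.trans (by rw [hT]; exact_mod_cast ht1)
  have hTt : T / 2 ≤ t' := by
    have : (2 * t₀ : ℝ) ≤ T := by rw [hT]; exact_mod_cast ht0
    have h2 : T = t₀ + t' := by rw [hT]; push_cast; rfl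
    linarith
  have hlogpos : 0 < log T := log_pos (by linarith)
  have hsqrt : √T ≤ a * k₁ * t' := by
    have h1 : √T ≤ a * k₁ * (T / 2) := by
      rw [sqrt_le_left (by positivity)]
      rw [div_le_iff₀ (by positivity)] at hT4
      nlinarith
    exact h1.trans (by gcongr)
  have hs : log T / (2 * a) ≤ rayCoord W (w (t₀ + t')) := by
    have h1 := log_le_log (by positivity) (hsqrt.trans (hexp t'))
    rw [log_exp, log_sqrt (by positivity)] at h1
    rw [div_le_iff₀ (by positivity)]
    linarith
  set s := rayCoord W (w (t₀ + t')) with hs_def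
  have hs0 : 0 < s := lt_of_lt_of_le (by positivity) hs
  have hdir : ‖W‖⁻¹ • W = ‖s • W‖⁻¹ • (s • W) := by
    rw [norm_smul, Real.norm_of_nonneg hs0.le, smul_smul]
    congr 1
    field_simp
  have hdev : ‖w (t₀ + t') - s • W‖ ≤ ‖v‖ + √M := by
    have h1 : w (t₀ + t') - s • W = v + rayDeviation W v (w (t₀ + t')) := by
      rw [rayDeviation, ← hs_def]; abel
    rw [h1]
    refine (norm_add_le _ _).trans ?_
    gcongr
    exact le_sqrt_of_sq_le (hD t')
  rw [hdir]
  refine (norm_inv_norm_smul_sub_le _ (smul_ne_zero hs0.ne' hW)).trans ?_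
  rw [norm_smul, Real.norm_of_nonneg hs0.le]
  calc 2 * ‖w (t₀ + t') - s • W‖ / (s * ‖W‖)
      ≤ 2 * (‖v‖ + √M) / (log T / (2 * a) * ‖W‖) := by gcongr
    _ = 2 * (‖v‖ + √M) * (2 * a) / ‖W‖ / log T := by field_simp

/-- Gradient descent on a loss of robust margins with a tight exponential tail converges in
direction to the max-margin vector, at a logarithmic rate, provided strict complementarity holds. -/
theorem exists_direction_rate [Nonempty ι] {S η a k τ μ : ℝ} {β : NNReal} {ℓ : ℝ → ℝ}
    (hℓ0 : ∀ u, 0 ≤ ℓ u) (hℓ : Differentiable ℝ ℓ)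
    (hanti : StrictAnti ℓ) (hlip : LipschitzWith β (deriv ℓ)) (hη : 0 < η) (hβ : 0 < β)
    (hηβ : η * (β * S ^ 2) < 2)
    (hlow : ∀ M : ℝ, ∃ δ : ℝ, 0 < δ ∧ ∀ u : ℝ, u ≤ M → deriv ℓ u ≤ -δ)
    (ha : 0 < a) (hk : 0 < k) (hτ : 0 < τ) (hμ : 0 < μ)
    (htail : ∀ u, τ < u → -deriv ℓ u ≤ k * (1 + exp (-μ * u)) * exp (-a * u) ∧
      k * (1 - exp (-μ * u)) * exp (-a * u) ≤ -deriv ℓ u)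
    (he : ∀ i, 0 ≤ e i)
    (hS : ∀ w, ∀ b : ι → ℝ, ‖∑ i, b i • marginGrad (z i) (e i) w‖ ^ 2 ≤ S ^ 2 * ∑ i, b i ^ 2)
    (hW : W ≠ 0) (h : IsRobustKKT z e W α)
    (hstrict : ∀ α', IsRobustKKT z e W α' → ∀ j, robustMargin (z j) (e j) W = 1 → 0 < α' j)
    {w : ℕ → E}
    (hw : ∀ t, w (t + 1) = w t + η • marginForce z e (fun u => -deriv ℓ u) (w t)) :
    ∃ (C : ℝ) (T : ℕ), ∀ t, T ≤ t →
      ‖‖w t‖⁻¹ • w t - ‖W‖⁻¹ • W‖ ≤ C / log t := by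
  have hN : 0 < ‖W‖ := norm_pos_iff.2 hW
  have hr0 : ∀ u, 0 ≤ -deriv ℓ u := fun u => by
    obtain ⟨δ, hδ, hb⟩ := hlow u
    linarith [hb u le_rfl]
  obtain ⟨R₀, hR₀⟩ := tail_bounded (r := fun u => -deriv ℓ u) hlip.continuous.neg ha hk hτ hμ
    fun u hu => (htail u hu).1
  obtain ⟨K, hK⟩ := two_mul_add_sq_bounded (r := fun u => -deriv ℓ u) (β := β) (q := η * S ^ 2)
    (by exact_mod_cast hβ) (by positivity)
    (by rw [lt_div_iff₀ (by exact_mod_cast hβ)]; linarith) hr0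
    (fun u => by
      have := hlip.dist_le_mul 0 u
      rw [Real.dist_eq, Real.dist_eq, zero_sub, abs_neg] at this
      linarith [le_abs_self (deriv ℓ 0 - deriv ℓ u)]) hR₀
  obtain ⟨κ, hκ, hev⟩ := exists_eventually_margin_ge hℓ0 hℓ hanti hlip hη hηβ he hr0 hlow
    (fun u hu => (hR₀ u hu).1) hK hS h.feasible hw
  obtain ⟨v, c, Θ, hΘ, hWv, hvc, hc, hexp⟩ := exists_offset hW h hstrict ha
  obtain ⟨U, hU, hU4⟩ : ∃ U, τ < U ∧ exp (-μ * U) ≤ 1 / 4 := by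
    have h4 : 0 < log 4 := log_pos (by norm_num)
    refine ⟨τ + log 4 / μ, by linarith [div_pos h4 hμ], ?_⟩
    have h1 : -μ * (τ + log 4 / μ) ≤ -log 4 := by
      have : -μ * (τ + log 4 / μ) = -(μ * τ) - log 4 := by field_simp; ring
      rw [this]
      have := mul_pos hμ hτ
      linarith
    refine (exp_le_exp.2 h1).trans ?_
    rw [exp_neg, exp_log (by norm_num)]
    norm_num
  obtain ⟨s₀, C, hC, hforce⟩ := inner_marginForce_rayDeviation_le ha hk hτ hμ hr0 htail hU hU4 he
    hW h hΘ hWv hvc hc hexp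
  obtain ⟨t₀, ht₀⟩ := hev (max U (max 1 s₀))
  have hu : ∀ t i, U ≤ robustMargin (z i) (e i) (w (t₀ + t)) := fun t i =>
    (le_max_left _ _).trans ((ht₀ (t₀ + t) (by omega)).1 i)
  have hray : ∀ t, max U (max 1 s₀) ≤ rayCoord W (w (t₀ + t)) := fun t =>
    le_rayCoord he hW h (ht₀ (t₀ + t) (by omega)).1
  have hs1 : ∀ t, 1 ≤ rayCoord W (w (t₀ + t)) := fun t =>
    (le_max_left 1 s₀).trans ((le_max_right _ _).trans (hray t))
  have hs0 : ∀ t, s₀ ≤ rayCoord W (w (t₀ + t)) := fun t =>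
    (le_max_right 1 s₀).trans ((le_max_right _ _).trans (hray t))
  set L : ℕ → ℝ := fun t => ∑ i, ℓ (robustMargin (z i) (e i) (w (t₀ + t))) with hLdef
  set x : ℕ → ℝ := fun t => ‖w (t₀ + t + 1) - w (t₀ + t)‖ ^ 2 with hx
  have hL0 : ∀ t, 0 ≤ L t := fun t => Finset.sum_nonneg fun i _ => hℓ0 _
  have hx0 : ∀ t, 0 ≤ x t := fun t => sq_nonneg _
  have hL : ∀ t, L (t + 1) + κ * x t ≤ L t := fun t => (ht₀ (t₀ + t) (by omega)).2
  have hLanti : Antitone L := antitone_nat_of_succ_le fun t => by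
    have := mul_nonneg hκ.le (hx0 t)
    linarith [hL t]
  set F : ℕ → E := fun t => marginForce z e (fun u => -deriv ℓ u) (w (t₀ + t)) with hF
  have hwF : ∀ t, w (t₀ + t + 1) = w (t₀ + t) + η • F t := fun t => hw _
  have hgrow : ∀ t, rayCoord W (w (t₀ + t)) + η * (k / 2) / ‖W‖ ^ 2 *
      exp (-a * rayCoord W (w (t₀ + t))) ≤ rayCoord W (w (t₀ + (t + 1))) := by
    intro t
    have h1 := exp_rayCoord_le_sum_rate hk ha hμ hr0 (fun u hu => (htail u hu).2) hU hU4 he hW h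
      (hu t)
    have h2 := h1.trans (sum_rate_le_inner_marginForce he hr0 h.feasible (w (t₀ + t)))
    rw [← add_assoc, hwF, rayCoord_add]
    gcongr
    rw [rayCoord.eq_1 W (η • F t), real_inner_smul_right, real_inner_comm,
      le_div_iff₀ (by positivity)]
    calc _ = η * (k / 2 * exp (-a * rayCoord W (w (t₀ + t)))) := by field_simp
      _ ≤ _ := by gcongr
  have hxle : ∀ t, x t ≤ L 0 / κ := fun t => by
    rw [le_div_iff₀ hκ]
    linarith [hL t, hL0 (t + 1), hLanti (Nat.zero_le t)]
  -- Step lengths are bounded because the loss, nonnegative and decreasing, pays `κ` times each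
  -- squared step.
  have hinc : ∀ t, rayCoord W (w (t₀ + (t + 1))) ≤
      rayCoord W (w (t₀ + t)) + √(L 0 / κ) / ‖W‖ := by
    intro t
    rw [← add_assoc, hwF, rayCoord_add]
    gcongr
    have h1 : ‖η • F t‖ ≤ √(L 0 / κ) := by
      refine le_sqrt_of_sq_le ?_
      have := hxle t
      simp only [hx] at this
      rwa [show w (t₀ + t + 1) - w (t₀ + t) = η • F t by rw [hwF]; abel] at this
    rw [rayCoord, div_le_div_iff₀ (by positivity) hN]
    have h2 := real_inner_le_norm W (η • F t)
    calc inner ℝ W (η • F t) * ‖W‖ ≤ (‖W‖ * √(L 0 / κ)) * ‖W‖ := by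
          gcongr
          exact h2.trans (by gcongr)
      _ = _ := by ring
  have hD : ∀ t, ‖rayDeviation W v (w (t₀ + (t + 1)))‖ ^ 2 ≤
      ‖rayDeviation W v (w (t₀ + t))‖ ^ 2 + 2 * η * C * (exp (-a * rayCoord W (w (t₀ + t))) /
        rayCoord W (w (t₀ + t)) ^ 2) * (1 + ‖rayDeviation W v (w (t₀ + t))‖ ^ 2) + x t := by
    intro t
    have h1 := norm_sq_rayDeviation_add_le hW hWv (w (t₀ + t)) (η • F t)
    have h2 := hforce (w (t₀ + t)) (hu t) (hs1 t) (hs0 t)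
    have hxt : x t = ‖η • F t‖ ^ 2 := by
      simp only [hx]
      rw [show w (t₀ + t + 1) - w (t₀ + t) = η • F t by rw [hwF]; abel]
    rw [← add_assoc, hwF, hxt]
    rw [real_inner_smul_left] at h1
    have h3 := mul_le_mul_of_nonneg_left h2 hη.le
    refine h1.trans ?_
    linarith
  obtain ⟨M, hM⟩ := bounded_of_exp_driven (s := fun t => rayCoord W (w (t₀ + t)))
    (D := fun t => ‖rayDeviation W v (w (t₀ + t))‖ ^ 2) (L := L) (x := x)
    (by positivity : 0 < η * (k / 2) / ‖W‖ ^ 2) (by positivity) (by positivity) hκ hs1 hgrow hinc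
    (fun t => sq_nonneg _) hL0 hx0 hD hL
  exact exists_rate_of_bounded_deviation hW ha (by positivity : 0 < η * (k / 2) / ‖W‖ ^ 2) t₀ hM
    (mul_le_exp_of_exp_growth (s := fun t => rayCoord W (w (t₀ + t))) ha hgrow)

end Rate

section Gradient

variable {E : Type*} [NormedAddCommGroup E] [InnerProductSpace ℝ E] {ι : Type*} [Fintype ι]
  {z : ι → E} {e : ι → ℝ}

/-! ### The gradient of the robust loss -/

theorem hasFDerivAt_robustMargin (z : E) {e : ℝ} {w : E} (h : w ≠ 0 ∨ e = 0) :
    HasFDerivAt (robustMargin z e) (innerSL ℝ (marginGrad z e w)) w := by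
  have hz : HasFDerivAt (fun w : E => inner ℝ z w) (innerSL ℝ z) w := (innerSL ℝ z).hasFDerivAt
  rcases h with hw | rfl
  · have hN : ‖w‖ ≠ 0 := norm_ne_zero_iff.2 hw
    have h1 := (hasStrictFDerivAt_norm_sq w).hasFDerivAt.sqrt (by positivity)
    simp only [Real.sqrt_sq (norm_nonneg _)] at h1
    refine (hz.sub (h1.const_mul e)).congr_fderiv ?_
    ext v
    simp only [sub_apply, smul_apply, innerSL_apply_apply,
      inner_marginGrad, real_inner_smul_left, smul_eq_mul, nsmul_eq_mul]
    field_simp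
    norm_num
    ring
  · have : robustMargin z 0 = fun w => inner ℝ z w := by ext; simp [robustMargin]
    rw [this, marginGrad, zero_smul, sub_zero]
    exact hz

theorem hasGradientAt_sum_robustMargin [CompleteSpace E] {ℓ : ℝ → ℝ} (hℓ : Differentiable ℝ ℓ)
    {w : E} (h : ∀ i, w ≠ 0 ∨ e i = 0) :
    HasGradientAt (fun w => ∑ i, ℓ (robustMargin (z i) (e i) w))
      (-marginForce z e (fun u => -deriv ℓ u) w) w := by
  rw [hasGradientAt_iff_hasFDerivAt]
  have h1 : ∀ i ∈ Finset.univ, HasFDerivAt (fun w => ℓ (robustMargin (z i) (e i) w))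
      (deriv ℓ (robustMargin (z i) (e i) w) • innerSL ℝ (marginGrad (z i) (e i) w)) w :=
    fun i _ => (hℓ _).hasDerivAt.comp_hasFDerivAt w (hasFDerivAt_robustMargin (z i) (h i))
  refine (HasFDerivAt.fun_sum h1).congr_fderiv ?_
  ext v
  simp [marginForce]

/-- The robust loss is not differentiable at the origin unless all perturbation levels vanish. -/
theorem eq_zero_of_differentiableAt_zero {ℓ : ℝ → ℝ} (hℓ : Differentiable ℝ ℓ)
    (hneg : deriv ℓ 0 < 0) (he : ∀ i, 0 ≤ e i) {v : E} (hv : v ≠ 0)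
    (hd : DifferentiableAt ℝ (fun w => ∑ i, ℓ (robustMargin (z i) (e i) w)) 0) (i : ι) :
    e i = 0 := by
  set f : E → ℝ := fun w => ∑ i, ℓ (robustMargin (z i) (e i) w) with hf
  have hline : ∀ v : E, HasDerivAt (fun t : ℝ => f (t • v)) (fderiv ℝ f 0 v) 0 := by
    intro v
    have h1 : HasDerivAt (fun t : ℝ => t • v) v 0 := by
      simpa using (hasDerivAt_id (0 : ℝ)).smul_const v
    have h2 : HasFDerivAt f (fderiv ℝ f 0) ((0 : ℝ) • v) := by
      rw [zero_smul]; exact hd.hasFDerivAt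
    exact h2.comp_hasDerivAt 0 h1
  -- Differentiability makes the derivatives along `v` and `-v` cancel, whereas the norm terms
  -- contribute `-2 * deriv ℓ 0 * ‖v‖ * e i ≥ 0` on both rays together.
  have hφ := ((hline v).add (hline (-v))).hasDerivWithinAt (s := Set.Ici 0)
  have hray : ∀ v : E, HasDerivWithinAt (fun t : ℝ => f (t • v))
      (∑ i, deriv ℓ 0 * robustMargin (z i) (e i) v) (Set.Ici 0) 0 := by
    intro v
    have h1 : HasDerivAt (fun t : ℝ => ∑ i, ℓ (t * robustMargin (z i) (e i) v))
        (∑ i, deriv ℓ 0 * robustMargin (z i) (e i) v) 0 := by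
      refine HasDerivAt.fun_sum fun i _ => ?_
      have h2 : HasDerivAt (fun t : ℝ => t * robustMargin (z i) (e i) v)
          (robustMargin (z i) (e i) v) 0 := by
        simpa using (hasDerivAt_id (0 : ℝ)).mul_const (robustMargin (z i) (e i) v)
      have h3 : HasDerivAt ℓ (deriv ℓ 0) (0 * robustMargin (z i) (e i) v) := by
        rw [zero_mul]; exact (hℓ 0).hasDerivAt
      exact h3.comp 0 h2
    refine h1.hasDerivWithinAt.congr (fun t ht => ?_) (by simp [hf, robustMargin])
    simp only [hf]
    exact Finset.sum_congr rfl fun i _ => by rw [robustMargin_smul _ _ _ ht]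
  have huniq := (uniqueDiffWithinAt_Ici (0 : ℝ)).eq_deriv _ hφ ((hray v).add (hray (-v)))
  rw [map_neg, add_neg_cancel, ← Finset.sum_add_distrib] at huniq
  have h1 : ∀ i, deriv ℓ 0 * robustMargin (z i) (e i) v +
      deriv ℓ 0 * robustMargin (z i) (e i) (-v) = -deriv ℓ 0 * (2 * ‖v‖) * e i := fun i => by
    simp only [robustMargin, inner_neg_right, norm_neg]; ring
  simp_rw [h1] at huniq
  rw [← Finset.mul_sum] at huniq
  have hpos : 0 < -deriv ℓ 0 * (2 * ‖v‖) := by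
    have := norm_pos_iff.2 hv
    have : 0 < -deriv ℓ 0 := by linarith
    positivity
  have hsum := (mul_eq_zero.1 huniq.symm).resolve_left hpos.ne'
  exact (Finset.sum_eq_zero_iff_of_nonneg fun i _ => he i).1 hsum i (Finset.mem_univ _)

theorem gradient_sum_robustMargin [CompleteSpace E] {ℓ : ℝ → ℝ} (hℓ : Differentiable ℝ ℓ)
    (hneg : deriv ℓ 0 < 0) (he : ∀ i, 0 ≤ e i) {v : E} (hv : v ≠ 0) {w : E}
    (hd : DifferentiableAt ℝ (fun w => ∑ i, ℓ (robustMargin (z i) (e i) w)) w) :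
    gradient (fun w => ∑ i, ℓ (robustMargin (z i) (e i) w)) w =
      -marginForce z e (fun u => -deriv ℓ u) w := by
  refine (hasGradientAt_sum_robustMargin hℓ fun i => ?_).gradient
  rcases eq_or_ne w 0 with rfl | hw
  · exact Or.inr (eq_zero_of_differentiableAt_zero hℓ hneg he hv hd i)
  · exact Or.inl hw

/-- Expand `v` in an eigenbasis of `T* T`, whose eigenvalues are the squared singular values. -/
theorem norm_apply_le_singularValues_zero_mul {F G : Type*} [NormedAddCommGroup F]
    [InnerProductSpace ℝ F] [FiniteDimensional ℝ F] [NormedAddCommGroup G] [InnerProductSpace ℝ G]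
    [FiniteDimensional ℝ G] (T : F →ₗ[ℝ] G) (v : F) :
    ‖T v‖ ≤ T.singularValues 0 * ‖v‖ := by
  have hsym := T.isSymmetric_adjoint_comp_self
  set b := hsym.eigenvectorBasis rfl with hb
  have h1 : ‖T v‖ ^ 2 = ∑ i : Fin (Module.finrank ℝ F),
      T.singularValues i ^ 2 * inner ℝ v (b i) ^ 2 := by
    rw [← real_inner_self_eq_norm_sq, ← LinearMap.adjoint_inner_left, ← LinearMap.comp_apply,
      ← b.sum_inner_mul_inner]
    refine Finset.sum_congr rfl fun i _ => ?_
    rw [hsym v (b i), hb, hsym.apply_eigenvectorBasis, T.sq_singularValues_fin rfl i,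
      real_inner_comm v, real_inner_smul_right]
    simp only [RCLike.ofReal_real_eq_id, id_eq]
    ring
  have h2 : ‖v‖ ^ 2 = ∑ i, inner ℝ v (b i) ^ 2 := by
    rw [← real_inner_self_eq_norm_sq, ← b.sum_inner_mul_inner]
    exact Finset.sum_congr rfl fun i _ => by rw [real_inner_comm v, sq]
  refine le_of_sq_le_sq ?_ (mul_nonneg (T.singularValues_nonneg 0) (norm_nonneg v))
  rw [mul_pow, h1, h2, Finset.mul_sum]
  refine Finset.sum_le_sum fun i _ => ?_
  have h3 : T.singularValues i ≤ T.singularValues 0 := T.singularValues_antitone (Nat.zero_le _)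
  have h4 := T.singularValues_nonneg i
  gcongr

end Gradient

/-! ### The data matrix, the robust loss and the classifier. -/

section Euclidean

variable {n p : ℕ}

theorem norm_sum_smul_le_sigmaMax (x : Fin n → EuclideanSpace ℝ (Fin p)) (b : Fin n → ℝ) :
    ‖∑ i, b i • x i‖ ≤ sigmaMax (dataMatrix x) * √(∑ i, b i ^ 2) := by
  set v := ∑ i, b i • x i with hv
  set T := Matrix.toEuclideanLin (dataMatrix x) with hT
  have hTv : ∀ i, T v i = inner ℝ (x i) v := by
    intro i
    rw [hT, Matrix.toLpLin_apply]
    simp [Matrix.mulVec, dotProduct, dataMatrix, PiLp.inner_apply, mul_comm]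
  have h1 : ‖v‖ ^ 2 = inner ℝ (WithLp.toLp 2 b : EuclideanSpace ℝ (Fin n)) (T v) := by
    conv_lhs => rw [← real_inner_self_eq_norm_sq, hv, sum_inner, ← hv]
    rw [PiLp.inner_apply]
    refine Finset.sum_congr rfl fun i _ => ?_
    rw [hTv, real_inner_smul_left]
    simp [mul_comm]
  have h2 : ‖(WithLp.toLp 2 b : EuclideanSpace ℝ (Fin n))‖ = √(∑ i, b i ^ 2) := by
    rw [EuclideanSpace.norm_eq]
    simp
  have h3 : ‖v‖ ^ 2 ≤ √(∑ i, b i ^ 2) * (sigmaMax (dataMatrix x) * ‖v‖) := by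
    rw [h1, ← h2]
    refine (real_inner_le_norm _ _).trans ?_
    gcongr
    exact norm_apply_le_singularValues_zero_mul T v
  rcases (norm_nonneg v).eq_or_lt with h | h
  · rw [← h]
    exact mul_nonneg (LinearMap.singularValues_nonneg _ _) (sqrt_nonneg _)
  · refine le_of_mul_le_mul_right ?_ h
    linarith [sq ‖v‖]

/-- The gradients form the signed data matrix minus the rank-one matrix of `ε` and the direction of
`w`; this is the source of `σ_max + ‖ε‖` in the step-size bound. -/
theorem norm_sq_sum_smul_marginGrad_le {y : Fin n → ℝ} (hy : ∀ i, y i = 1 ∨ y i = -1)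
    (x : Fin n → EuclideanSpace ℝ (Fin p)) (ε : EuclideanSpace ℝ (Fin n))
    (w : EuclideanSpace ℝ (Fin p)) (b : Fin n → ℝ) :
    ‖∑ i, b i • marginGrad (y i • x i) (ε i) w‖ ^ 2 ≤
      (sigmaMax (dataMatrix x) + ‖ε‖) ^ 2 * ∑ i, b i ^ 2 := by
  have hσ : 0 ≤ sigmaMax (dataMatrix x) := LinearMap.singularValues_nonneg _ _
  have hQ : 0 ≤ ∑ i, b i ^ 2 := Finset.sum_nonneg fun i _ => sq_nonneg _
  have h1 : ∑ i, b i • marginGrad (y i • x i) (ε i) w =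
      ∑ i, (b i * y i) • x i - (∑ i, b i * ε i) • (‖w‖⁻¹ • w) := by
    rw [Finset.sum_smul, ← Finset.sum_sub_distrib]
    refine Finset.sum_congr rfl fun i _ => ?_
    rw [marginGrad, smul_sub, smul_smul, smul_smul (b i) (ε i)]
  have h2 : ‖∑ i, (b i * y i) • x i‖ ≤ sigmaMax (dataMatrix x) * √(∑ i, b i ^ 2) := by
    have h := norm_sum_smul_le_sigmaMax x fun i => b i * y i
    have hy2 : ∀ i, (b i * y i) ^ 2 = b i ^ 2 := fun i => by
      rcases hy i with h | h <;> rw [h] <;> ring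
    simpa only [hy2] using h
  have h3 : |∑ i, b i * ε i| ≤ ‖ε‖ * √(∑ i, b i ^ 2) := by
    rw [EuclideanSpace.norm_eq, ← sqrt_mul (Finset.sum_nonneg fun i _ => sq_nonneg _)]
    refine abs_le_sqrt ?_
    have := Finset.sum_mul_sq_le_sq_mul_sq Finset.univ b (fun i => ε i)
    simp only [norm_eq_abs, sq_abs]
    linarith
  have h4 : ‖∑ i, b i • marginGrad (y i • x i) (ε i) w‖ ≤
      (sigmaMax (dataMatrix x) + ‖ε‖) * √(∑ i, b i ^ 2) := by
    rw [h1, add_mul]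
    refine (norm_sub_le _ _).trans (add_le_add h2 ?_)
    rw [norm_smul, norm_eq_abs]
    calc _ ≤ ‖ε‖ * √(∑ i, b i ^ 2) * 1 := by
          gcongr
          exact norm_inv_norm_smul_le w
      _ = _ := mul_one _
  calc _ ≤ ((sigmaMax (dataMatrix x) + ‖ε‖) * √(∑ i, b i ^ 2)) ^ 2 := by gcongr
    _ = _ := by rw [mul_pow, sq_sqrt hQ]

theorem robustLoss_eq_sum {ℓ : ℝ → ℝ} (hℓ : Antitone ℓ) {ε : EuclideanSpace ℝ (Fin n)}
    (hε : ∀ i, 0 ≤ ε i) {y : Fin n → ℝ} (hy : ∀ i, y i = 1 ∨ y i = -1)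
    (x : Fin n → EuclideanSpace ℝ (Fin p)) :
    robustLoss ℓ ε y x = fun w => ∑ i, ℓ (robustMargin (y i • x i) (ε i) w) := by
  funext w
  refine Finset.sum_congr rfl fun i _ => IsGreatest.csSup_eq ⟨?_, ?_⟩
  -- The worst perturbation pushes the point straight against the label; for `w = 0` it degenerates
  -- harmlessly to `0`.
  · refine ⟨-(y i * ε i) • (‖w‖⁻¹ • w), ?_, ?_⟩
    · have hyi : |y i| = 1 := by rcases hy i with h | h <;> rw [h] <;> simp
      rw [mem_closedBall_zero_iff, norm_smul, norm_neg, norm_mul, norm_eq_abs, hyi, one_mul,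
        Real.norm_of_nonneg (hε i)]
      exact mul_le_of_le_one_right (hε i) (norm_inv_norm_smul_le w)
    · have hyi : y i * y i = 1 := by rcases hy i with h | h <;> rw [h] <;> norm_num
      simp only [robustMargin]
      congr 1
      rw [inner_add_left, real_inner_smul_left, inner_inv_norm_smul_self, real_inner_smul_left]
      linear_combination -(ε i * ‖w‖) * hyi
  · rintro _ ⟨v, hv, rfl⟩
    rw [mem_closedBall_zero_iff] at hv
    refine hℓ ?_
    rw [robustMargin, inner_add_left, real_inner_smul_left]
    have h1 : |inner ℝ v w| ≤ ε i * ‖w‖ :=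
      (abs_real_inner_le_norm v w).trans (by gcongr)
    rw [abs_le] at h1
    rcases hy i with h | h <;> rw [h] <;> linarith

theorem robustFeasible_iff {ε : EuclideanSpace ℝ (Fin n)} {y : Fin n → ℝ}
    {x : Fin n → EuclideanSpace ℝ (Fin p)} {w : EuclideanSpace ℝ (Fin p)} :
    RobustFeasible ε y x w ↔ ∀ i, 1 ≤ robustMargin (y i • x i) (ε i) w := by
  simp only [RobustFeasible, robustMargin, real_inner_smul_left, le_sub_iff_add_le]

theorem tendsto_classifier {w : ℕ → EuclideanSpace ℝ (Fin p)} {W v : EuclideanSpace ℝ (Fin p)}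
    (h : Tendsto (fun t => direction (w t)) atTop (𝓝 (direction W)))
    (hv : inner ℝ W v ≠ 0) :
    Tendsto (fun t => classifier (w t) v) atTop (𝓝 (classifier W v)) := by
  have hW : W ≠ 0 := by rintro rfl; simp at hv
  have hsign : ∀ u : EuclideanSpace ℝ (Fin p), inner ℝ (direction u) v = ‖u‖⁻¹ * inner ℝ u v :=
    fun u => real_inner_smul_left _ _ _
  have hinner : Tendsto (fun t => inner ℝ (direction (w t)) v) atTop
      (𝓝 (inner ℝ (direction W) v)) := h.inner tendsto_const_nhds
  have hN : 0 < ‖W‖⁻¹ := inv_pos.2 (norm_pos_iff.2 hW)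
  refine tendsto_const_nhds.congr' ?_
  rcases hv.lt_or_gt with hlt | hgt
  · have h1 : inner ℝ (direction W) v < 0 := by
      rw [hsign]; exact mul_neg_of_pos_of_neg hN hlt
    filter_upwards [hinner.eventually (gt_mem_nhds h1)] with t ht
    rw [hsign] at ht
    have h2 : inner ℝ (w t) v < 0 := by
      by_contra! hge
      exact ht.not_ge (mul_nonneg (by positivity) hge)
    rw [classifier, classifier, Real.sign_of_neg hlt, Real.sign_of_neg h2]
  · have h1 : 0 < inner ℝ (direction W) v := by
      rw [hsign]; exact mul_pos hN hgt
    filter_upwards [hinner.eventually (lt_mem_nhds h1)] with t ht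
    rw [hsign] at ht
    have h2 : 0 < inner ℝ (w t) v := by
      by_contra! hle
      exact ht.not_ge (mul_nonpos_of_nonneg_of_nonpos (by positivity) hle)
    rw [classifier, classifier, Real.sign_of_pos hgt, Real.sign_of_pos h2]

theorem exists_forall_le_div_log {f : ℕ → ℝ} {B C : ℝ} {T : ℕ} (hB : ∀ t, f t ≤ B)
    (hf : ∀ t, T ≤ t → f t ≤ C / log t) : ∃ C', ∀ t : ℕ, 2 ≤ t → f t ≤ C' / log t := by
  refine ⟨|B| * log T + |C|, fun t ht => ?_⟩
  have ht' : (2 : ℝ) ≤ t := by exact_mod_cast ht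
  have hlog : 0 < log t := log_pos (by linarith)
  rcases le_or_gt T t with h | h
  · refine (hf t h).trans ?_
    gcongr
    have : 0 ≤ |B| * log T := mul_nonneg (abs_nonneg B) (log_natCast_nonneg T)
    linarith [le_abs_self C]
  · rw [le_div_iff₀ hlog]
    have h1 : log t ≤ log T := log_le_log (by linarith) (by exact_mod_cast h.le)
    have h2 : f t * log t ≤ |B| * log T := by
      calc f t * log t ≤ |B| * log t := by
            gcongr; exact (hB t).trans (le_abs_self B)
        _ ≤ _ := by gcongr
    linarith [abs_nonneg C]

end Euclidean

theorem theorem1 {n p : ℕ} (hn : 0 < n)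
    (ℓ : ℝ → ℝ) (β : NNReal)
    (hℓ_nonneg : ∀ u, 0 ≤ ℓ u)
    (hℓ_diff : Differentiable ℝ ℓ) (hℓ_diff2 : Differentiable ℝ (deriv ℓ))
    (hℓ_anti : StrictAnti ℓ)
    (hℓ_deriv : ∀ M : ℝ, ∃ δ : ℝ, 0 < δ ∧ ∀ u : ℝ, u ≤ M → deriv ℓ u ≤ -δ)
    (hℓ_smooth : LipschitzWith β (deriv ℓ))
    (hℓ_tail : TightExponentialTail (fun u => -deriv ℓ u))
    (ε : EuclideanSpace ℝ (Fin n)) (hε : ∀ i, 0 ≤ ε i)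
    (y : Fin n → ℝ) (hy : ∀ i, y i = 1 ∨ y i = -1) :
    ∀ᵐ x : Fin n → EuclideanSpace ℝ (Fin p) ∂(MeasureTheory.volume),
      ∀ wRM : EuclideanSpace ℝ (Fin p), IsRobustMaxMargin ε y x wRM →
      ∀ η : ℝ, 0 < η → η < 2 * (β : ℝ)⁻¹ * ((sigmaMax (dataMatrix x) + ‖ε‖) ^ 2)⁻¹ →
      ∀ w : ℕ → EuclideanSpace ℝ (Fin p), IsGradientDescent (robustLoss ℓ ε y x) η w →
        Filter.Tendsto (fun t => ‖direction (w t) - direction wRM‖) Filter.atTop (nhds 0) ∧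
        (∃ C : ℝ, ∀ t : ℕ, 2 ≤ t → ‖direction (w t) - direction wRM‖ ≤ C / Real.log t) ∧
        (∀ᵐ v : EuclideanSpace ℝ (Fin p) ∂(MeasureTheory.volume),
          Filter.Tendsto (fun t => classifier (w t) v) Filter.atTop
            (nhds (classifier wRM v))) := by
  have hy0 : ∀ i, y i ≠ 0 := fun i => by rcases hy i with h | h <;> rw [h] <;> norm_num
  have hstrict := ae_strict_complementarity
    (MeasureTheory.volume : MeasureTheory.Measure (Fin n → EuclideanSpace ℝ (Fin p)))
    (fun i => ε i) y hε hy0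
  filter_upwards [hstrict] with x hx W hWRM η hη hηlt w hw
  have : Nonempty (Fin n) := ⟨⟨0, hn⟩⟩
  have hfeas := robustFeasible_iff.1 hWRM.1
  have hW : W ≠ 0 := by
    rintro rfl
    have := hfeas ⟨0, hn⟩
    norm_num [robustMargin] at this
  obtain ⟨α, hα⟩ := exists_isRobustKKT hε hW hfeas fun v hv => hWRM.2 v (robustFeasible_iff.2 hv)
  set S := sigmaMax (dataMatrix x) + ‖ε‖ with hS
  -- With `0⁻¹ = 0`, an admissible `η` can exist only if `β` and `S` are nonzero.
  have hprod : 0 < 2 * (β : ℝ)⁻¹ * (S ^ 2)⁻¹ := hη.trans hηlt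
  have hβ : 0 < β := by
    rcases eq_or_ne β 0 with h | h
    · simp [h] at hprod
    · exact pos_iff_ne_zero.2 h
  have hβ' : (0 : ℝ) < β := by exact_mod_cast hβ
  have hS2 : 0 < S ^ 2 := by
    rcases (sq_nonneg S).eq_or_lt with h | h
    · simp [← h] at hprod
    · exact h
  have hηβ : η * (β * S ^ 2) < 2 := by
    have h1 : 2 * (β : ℝ)⁻¹ * (S ^ 2)⁻¹ = 2 / (β * S ^ 2) := by field_simp
    rw [h1, lt_div_iff₀ (by positivity)] at hηlt
    exact hηlt
  obtain ⟨a, k, τ, μ, ha, hk, hτ, hμ, htail⟩ := hℓ_tail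
  have hneg : deriv ℓ 0 < 0 := by
    obtain ⟨δ, hδ, h⟩ := hℓ_deriv 0
    linarith [h 0 le_rfl]
  have hstep : ∀ t, w (t + 1) = w t +
      η • marginForce (fun i => y i • x i) (fun i => ε i) (fun u => -deriv ℓ u) (w t) := by
    intro t
    obtain ⟨hd, hwt⟩ := hw t
    rw [robustLoss_eq_sum hℓ_anti.antitone hε hy] at hd hwt
    have hgrad := gradient_sum_robustMargin (z := fun i => y i • x i) (e := fun i => ε i) hℓ_diff
      hneg hε hW hd
    rw [hwt, hgrad, smul_neg, sub_neg_eq_add]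
  obtain ⟨C, T, hrate⟩ := exists_direction_rate hℓ_nonneg hℓ_diff hℓ_anti hℓ_smooth hη hβ hηβ
    hℓ_deriv ha hk hτ hμ htail hε
    (fun w b => norm_sq_sum_smul_marginGrad_le hy x ε w b) hW hα (fun α' => hx W α') hstep
  have hbound : ∀ t, ‖direction (w t) - direction W‖ ≤ 2 := fun t => by
    refine (norm_sub_le _ _).trans ?_
    have h1 : ‖direction (w t)‖ ≤ 1 := norm_inv_norm_smul_le (w t)
    have h2 : ‖direction W‖ ≤ 1 := norm_inv_norm_smul_le W
    linarith
  have htend : Tendsto (fun t => ‖direction (w t) - direction W‖) atTop (𝓝 0) := by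
    have hlog : Tendsto (fun t : ℕ => C / log t) atTop (𝓝 0) :=
      tendsto_const_nhds.div_atTop (tendsto_log_atTop.comp tendsto_natCast_atTop_atTop)
    exact squeeze_zero' (Eventually.of_forall fun t => norm_nonneg _)
      ((eventually_ge_atTop T).mono hrate) hlog
  refine ⟨htend, exists_forall_le_div_log hbound hrate, ?_⟩
  -- The sign is locally constant off the null hyperplane orthogonal to `W`.
  filter_upwards [ae_inner_ne MeasureTheory.volume hW 0] with v hv
  exact tendsto_classifier (tendsto_iff_norm_sub_tendsto_zero.2 htend) hv
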